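/- **Theorem 4.9.** For $R>0$ let $N_R=\{|z|<R\}\times S^1$ be the model tube with $S^1=\mathbb R/2\pi\mathbb Z$, core circle $\Sigma=\{0\}\times S^1$ and product metric $dr^2+r^2d\theta^2+dt^2$, where $z=x+iy=re^{i\theta}$. Let $\mathcal S$ be the spinor bundle of $N_R$ (for either of its spin structures) and $\mathcal I$ a flat real line bundle on $N_R\setminus\Sigma$ with monodromy $-1$ around $\Sigma$. In the parallel frame of $\mathcal S$ defined by $\partial_x,\partial_y,\partial_t$, sections of $\mathcal S\otimes\mathcal I$ are thus functions $v(r,\theta,t)\in\mathbb C^2$, $0<r<R$, with $v(r,\theta+2\pi,t)=-v(r,\theta,t)$ and $v(r,\theta,t+2\pi)=\varepsilon v(r,\theta,t)$ for a fixed sign $\varepsilon\in\{1,-1\}$, and the Dirac operator is $$D=\begin{pmatrix}-i&0\\0&i\end{pmatrix}\partial_t+\begin{pmatrix}0&1\\0&0\end{pmatrix}(\partial_x-i\partial_y)+\begin{pmatrix}0&0\\-1&0\end{pmatrix}(\partial_x+i\partial_y),\qquad \partial_x\mp i\partial_y=e^{\mp i\theta}\Big(\partial_r\mp\frac ir\partial_\theta\Big).$$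 Let $\|v\|^2_{L^2(N_\rho)}=\int_0^{\rho}\int_0^{2\pi}\int_0^{2\pi}|v|^2\,r\,dt\,d\theta\,dr$, and let $L^2_1(N_R)$ be the closure of the smooth sections $v$ over $N_R\setminus\Sigma$ for which $\|v\|_{L^2_1}^2=\int_{N_R}|v|^2+|\nabla v|^2$ is finite, in this norm; $\nabla v$ (so also $\partial_t v$ and $Dv$) is defined for $v\in L^2_1(N_R)$ as an $L^2$ limit. There is a constant $C>0$, independent of $R$, $r$, $v$ and of the choices of the spin structure and of $\mathcal I$, such that for all $R>0$, all $v\in L^2_1(N_R)$ with $Dv=0$, and all $0<r\le R/2$, $$\|v\|^2_{L^2(N_r)}\le C\,\frac{r^3}{R^3}\,\|v\|^2_{L^2(N_R)}\qquad\text{and}\qquad \|\partial_t v\|^2_{L^2(N_r)}\le C\,\frac{r^3}{R^5}\,\|v\|^2_{L^2(N_R)}.$$ -/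

import Mathlib

open MeasureTheory Filter Topology
open scoped ContDiff

namespace ZTwoSpinor

/-- Values of spinors in dimension three: `ℂ²` with its Hermitian norm. -/
abbrev Spinor : Type := EuclideanSpace ℂ (Fin 2)

/-- Points of the universal cover of the tube minus its core, in cylindrical coordinates
`p = (r, θ, t)`: `p.1 = r` is the distance to the core circle, `p.2.1 = θ` the angle around it,
and `p.2.2 = t` the coordinate along it. -/
abbrev Coord : Type := ℝ × ℝ × ℝ

/-- The part `0 < r < R` of the universal cover. -/
def tube (R : ℝ) : Set Coord := {p | 0 < p.1 ∧ p.1 < R}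

/-- The Riemannian measure `r dr dθ dt` of the product metric `dr² + r² dθ² + dt²`
on the tube `N_R`, carried by the fundamental domain `(0, R) × (0, 2π) × (0, 2π)`. -/
noncomputable def tubeMeasure (R : ℝ) : Measure Coord :=
  (volume.restrict
    (Set.Ioo 0 R ×ˢ Set.Ioo 0 (2 * Real.pi) ×ˢ Set.Ioo 0 (2 * Real.pi))).withDensity
    (fun p => ENNReal.ofReal p.1)

/-- Sections of the twisted spinor bundle `S ⊗ I` over `N_R` minus the core circle, seen as
`ℂ²`-valued functions on the universal cover (in the parallel frame of `S` given by the parallel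
orthonormal frame `∂_x, ∂_y, ∂_t`). The monodromy around the core is `-1` (this is `I`); the
monodromy `ε = ±1` along the core depends on the spin structure and on `I`. -/
def IsSection (ε : ℤˣ) (R : ℝ) (v : Coord → Spinor) : Prop :=
  ∀ r θ t : ℝ, (r, θ, t) ∈ tube R →
    v (r, θ + 2 * Real.pi, t) = -v (r, θ, t) ∧
    v (r, θ, t + 2 * Real.pi) = ((ε : ℤ) : ℂ) • v (r, θ, t)

/-- Components of the covariant derivative `∇u` of a differentiable section in the orthonormal
frame `∂_r, r⁻¹ ∂_θ, ∂_t`. The connection is flat, and the frame of the bundle is parallel. -/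
noncomputable def grad (u : Coord → Spinor) : Fin 3 → Coord → Spinor :=
  ![fun p => fderiv ℝ u p (1, 0, 0),
    fun p => p.1⁻¹ • fderiv ℝ u p (0, 1, 0),
    fun p => fderiv ℝ u p (0, 0, 1)]

/-- Smooth sections over `N_R` minus the core circle with finite `L²_1` norm. -/
structure IsSmoothLTwoOne (ε : ℤˣ) (R : ℝ) (u : Coord → Spinor) : Prop where
  isSection : IsSection ε R u
  smooth : ContDiffOn ℝ ∞ u (tube R)
  memLp : MemLp u 2 (tubeMeasure R)
  memLp_grad : ∀ i, MemLp (grad u i) 2 (tubeMeasure R)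

/-- `v` is an element of `L²_1(N_R; S ⊗ I)`, the closure in the `L²_1` norm of the smooth sections
of finite `L²_1` norm, and `G` is its covariant derivative `∇v`: there are smooth sections `u n`
of finite `L²_1` norm with `u n → v` and `∇(u n) → G` in `L²`. -/
structure HasLTwoOneGrad (ε : ℤˣ) (R : ℝ) (v : Coord → Spinor) (G : Fin 3 → Coord → Spinor) :
    Prop where
  isSection : IsSection ε R v
  memLp : MemLp v 2 (tubeMeasure R)
  memLp_grad : ∀ i, MemLp (G i) 2 (tubeMeasure R)
  approx : ∃ u : ℕ → Coord → Spinor, (∀ n, IsSmoothLTwoOne ε R (u n)) ∧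
    Tendsto (fun n => eLpNorm (u n - v) 2 (tubeMeasure R)) atTop (𝓝 0) ∧
    ∀ i, Tendsto (fun n => eLpNorm (grad (u n) i - G i) 2 (tubeMeasure R)) atTop (𝓝 0)

/-- The matrix `e₁`, Clifford multiplication by `∂_t`. -/
def eOne : Matrix (Fin 2) (Fin 2) ℂ := !![-Complex.I, 0; 0, Complex.I]

/-- The matrix `e₂`. -/
def eTwo : Matrix (Fin 2) (Fin 2) ℂ := !![0, 1; 0, 0]

/-- The matrix `e₃`. -/
def eThree : Matrix (Fin 2) (Fin 2) ℂ := !![0, 0; -1, 0]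

/-- The Dirac operator `D v = e₁ ∂_t v + e₂ (∂_x - i ∂_y) v + e₃ (∂_x + i ∂_y) v`, written through
the components `G = (∂_r v, r⁻¹ ∂_θ v, ∂_t v)` of `∇v` by means of
`∂_x ∓ i ∂_y = e^{∓iθ} (∂_r ∓ i r⁻¹ ∂_θ)`. -/
noncomputable def dirac (G : Fin 3 → Coord → Spinor) (p : Coord) : Fin 2 → ℂ :=
  eOne.mulVec (G 2 p).ofLp
  + eTwo.mulVec
      (Complex.exp (-(Complex.I * (p.2.1 : ℂ))) • (G 0 p - Complex.I • G 1 p)).ofLp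
  + eThree.mulVec
      (Complex.exp (Complex.I * (p.2.1 : ℂ)) • (G 0 p + Complex.I • G 1 p)).ofLp

/-- The squared `L²(N_R)` norm. -/
noncomputable def normSqLTwo (R : ℝ) (u : Coord → Spinor) : ℝ :=
  ∫ p, ‖u p‖ ^ 2 ∂(tubeMeasure R)

end ZTwoSpinor

namespace ZTwoSpinor

/-! ### Radial estimates for a single Fourier mode -/

/-! Expand `v` in Fourier modes in `θ` (half-integer frequencies, by the monodromy) and in `t`. The
Dirac equation couples frequency `κ` of the first component, `a`, with frequency `κ + 1` of the
second, `b`, at the same frequency `ℓ` in `t`: `a' = (κ/s) a - ℓ b`, `b' = -((κ+1)/s) b - ℓ a`. By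
Parseval (`tsum_lintegral_mode`) it suffices to bound each mode with a constant independent of the
mode, and `∂_t` acts on a mode as multiplication by `iℓ`.

No Bessel functions are needed. Put `X = |a|²`, `Y = |b|²`, `Z = Re⟨a, b⟩` and let `F = κX - ℓsZ =
sX'/2` be the flux. Then `F' = (|κa - ℓsb|² + κ²|a|²)/s + ℓ²sX ≥ 0`. Since `r⁻¹∂_θ v` is in `L²` and
no frequency in `θ` vanishes, `(X + Y)/s` is integrable; this excludes the singular solutions and
forces monotone quantities such as `F` to be nonnegative. The same argument for `2F - X`, using `κ²
≥ 1/4`, gives `X ≤ sX'` (`X_le_two_mul_flux`), so `X/s` is nondecreasing. Hence `∫₀^r sX` is at most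
a multiple of `(r³/R) X(R/2)`, while monotonicity of `X` bounds the integral up to `R` below by a
multiple of `R² X(R/2)`.

For `∂_t v` the factor `ℓ²` must be absorbed. Integrating `F' ≥ ℓ²sX` and then `X' = 2F/s` beyond
`R/2` shows that `X` near `R` is at least a multiple of `ℓ²R² X(R/2)` (`sq_mul_X_half_le`), which
gains `R⁻²`. The system is symmetric under exchanging `a` and `b` with `κ` replaced by `-(κ+1)`, so
the second component obeys the same bounds. -/

lemma nonneg_of_monotoneOn_of_integrableOn_div {h : ℝ → ℝ} {R : ℝ}
    (hm : MonotoneOn h (Set.Ioo 0 R)) (hi : IntegrableOn (fun s => h s / s) (Set.Ioo 0 R))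
    {s : ℝ} (hs : s ∈ Set.Ioo 0 R) : 0 ≤ h s := by
  by_contra! hneg
  have hsub : Set.Ioc 0 s ⊆ Set.Ioo 0 R := fun x hx => ⟨hx.1, hx.2.trans_lt hs.2⟩
  -- If `h s < 0`, monotonicity keeps `|h| ≥ |h s|` all the way to `0`, so integrability of `h x /
  -- x` would make `1/x` integrable there.
  have h1 : IntegrableOn (fun x : ℝ => x⁻¹) (Set.Ioc 0 s) := by
    refine Integrable.mono' (g := fun x => |h s|⁻¹ * |h x / x|)
      ((hi.mono_set hsub).abs.const_mul _) measurable_inv.aestronglyMeasurable ?_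
    refine (ae_restrict_iff' measurableSet_Ioc).2 (.of_forall fun x hx => ?_)
    have hxs : h x ≤ h s := hm (hsub hx) hs hx.2
    have hx0 : 0 < x := hx.1
    have h2 : |h s| ≤ |h x| := by
      rw [abs_of_neg hneg, abs_of_neg (hxs.trans_lt hneg)]; linarith
    have h3 : 0 < |h s| := abs_pos.2 hneg.ne
    rw [Real.norm_eq_abs, abs_inv, abs_div, abs_of_pos hx0, ← div_eq_inv_mul, inv_eq_one_div,
      le_div_iff₀ h3, div_mul_eq_mul_div, one_mul]
    gcongr
  have h4 := (intervalIntegrable_iff_integrableOn_Ioc_of_le hs.1.le).2 h1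
  rw [intervalIntegrable_inv_iff] at h4
  rcases h4 with h4 | h4
  · exact hs.1.ne h4
  · exact h4 (by simp)

/-- The quadratic quantities `X = |a|²`, `Y = |b|²`, `Z = Re ⟨a, b⟩` built from a solution `(a, b)`
on `(0, R)` of the radial system `a' = κ/s a - ℓ b`, `b' = -(κ+1)/s b - ℓ a` which is regular at
the core. -/
structure IsRadial (κ l R : ℝ) (X Y Z : ℝ → ℝ) : Prop where
  derivX : ∀ s ∈ Set.Ioo 0 R, HasDerivAt X (2 * κ / s * X s - 2 * l * Z s) s
  derivZ : ∀ s ∈ Set.Ioo 0 R, HasDerivAt Z (-Z s / s - l * (X s + Y s)) s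
  pos : ∀ s ∈ Set.Ioo 0 R, ∀ α β : ℝ, 0 ≤ α ^ 2 * X s + 2 * α * β * Z s + β ^ 2 * Y s
  integrable : IntegrableOn (fun s => (X s + Y s) / s) (Set.Ioo 0 R)

namespace IsRadial

variable {κ l R : ℝ} {X Y Z : ℝ → ℝ}

lemma X_nonneg (H : IsRadial κ l R X Y Z) {s : ℝ} (hs : s ∈ Set.Ioo 0 R) : 0 ≤ X s := by
  simpa using H.pos s hs 1 0

lemma Y_nonneg (H : IsRadial κ l R X Y Z) {s : ℝ} (hs : s ∈ Set.Ioo 0 R) : 0 ≤ Y s := by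
  simpa using H.pos s hs 0 1

lemma abs_Z_le (H : IsRadial κ l R X Y Z) {s : ℝ} (hs : s ∈ Set.Ioo 0 R) :
    |Z s| ≤ X s + Y s := by
  have h1 := H.pos s hs 1 1
  have h2 := H.pos s hs 1 (-1)
  have h3 := H.X_nonneg hs
  have h4 := H.Y_nonneg hs
  rw [abs_le]
  constructor <;> linarith

/-- The radial energy flux `κ X - ℓ s Z = s X' / 2`. -/
lemma hasDerivAt_flux (H : IsRadial κ l R X Y Z) {s : ℝ} (hs : s ∈ Set.Ioo 0 R) :
    HasDerivAt (fun s => κ * X s - l * (s * Z s))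
      ((2 * κ ^ 2 * X s - 2 * κ * (l * s) * Z s + (l * s) ^ 2 * Y s) / s + l ^ 2 * s * X s) s := by
  have hs0 : s ≠ 0 := hs.1.ne'
  refine (((H.derivX s hs).const_mul κ).sub
    (((hasDerivAt_id' s).mul (H.derivZ s hs)).const_mul l)).congr_deriv ?_
  field_simp
  ring

/-- The bracket is `|κa - ℓsb|² + κ²|a|²`, a sum of squares. -/
lemma flux_deriv_ge (H : IsRadial κ l R X Y Z) {s : ℝ} (hs : s ∈ Set.Ioo 0 R) :
    l ^ 2 * s * X s ≤
      (2 * κ ^ 2 * X s - 2 * κ * (l * s) * Z s + (l * s) ^ 2 * Y s) / s + l ^ 2 * s * X s := by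
  have h1 := H.pos s hs κ (-(l * s))
  have h2 := mul_nonneg (sq_nonneg κ) (H.X_nonneg hs)
  have : 0 ≤ (2 * κ ^ 2 * X s - 2 * κ * (l * s) * Z s + (l * s) ^ 2 * Y s) / s :=
    div_nonneg (by linarith) hs.1.le
  linarith

lemma continuousOn_X (H : IsRadial κ l R X Y Z) : ContinuousOn X (Set.Ioo 0 R) :=
  fun s hs => (H.derivX s hs).continuousAt.continuousWithinAt

lemma continuousOn_Z (H : IsRadial κ l R X Y Z) : ContinuousOn Z (Set.Ioo 0 R) :=
  fun s hs => (H.derivZ s hs).continuousAt.continuousWithinAt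

/-- With `c = 2κ` this concerns twice the flux, with `c = 2κ - 1` twice the flux minus `X`: the two
quantities whose sign is read off at the core. -/
lemma integrableOn_combination (H : IsRadial κ l R X Y Z) (c : ℝ) :
    IntegrableOn (fun s => (c * X s - 2 * (l * (s * Z s))) / s) (Set.Ioo 0 R) := by
  refine Integrable.mono' (g := fun s => (|c| + 2 * |l| * R) * ((X s + Y s) / s))
    (H.integrable.const_mul _) ?_ ?_
  · refine ContinuousOn.aestronglyMeasurable ?_ measurableSet_Ioo
    exact ((H.continuousOn_X.const_mul c).sub
      ((((continuousOn_id).mul H.continuousOn_Z).const_mul l).const_mul 2)).div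
      continuousOn_id fun s hs => hs.1.ne'
  · refine (ae_restrict_iff' measurableSet_Ioo).2 (.of_forall fun s hs => ?_)
    have hs0 : 0 < s := hs.1
    have hX := H.X_nonneg hs
    have hY := H.Y_nonneg hs
    have hZ := H.abs_Z_le hs
    rw [Real.norm_eq_abs, abs_div, abs_of_pos hs0, ← mul_div_assoc]
    gcongr
    calc |c * X s - 2 * (l * (s * Z s))| ≤ |c * X s| + |2 * (l * (s * Z s))| := abs_sub _ _
      _ = |c| * X s + 2 * |l| * s * |Z s| := by
        simp only [abs_mul, abs_of_nonneg hX, abs_of_pos hs0, abs_two]; ring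
      _ ≤ |c| * (X s + Y s) + 2 * |l| * R * (X s + Y s) := by
        have := hs.2.le
        have : 0 ≤ R := hs0.le.trans this
        gcongr
        linarith
      _ = _ := by ring

lemma monotoneOn_flux (H : IsRadial κ l R X Y Z) :
    MonotoneOn (fun s => κ * X s - l * (s * Z s)) (Set.Ioo 0 R) := by
  refine monotoneOn_of_deriv_nonneg (convex_Ioo 0 R)
    (fun s hs => (H.hasDerivAt_flux hs).continuousAt.continuousWithinAt)
    (fun s hs => ?_) fun s hs => ?_ <;> rw [interior_Ioo] at hs
  · exact (H.hasDerivAt_flux hs).differentiableAt.differentiableWithinAt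
  · rw [(H.hasDerivAt_flux hs).deriv]
    have := hs.1
    exact le_trans (by have := H.X_nonneg hs; positivity) (H.flux_deriv_ge hs)

lemma flux_nonneg (H : IsRadial κ l R X Y Z) {s : ℝ} (hs : s ∈ Set.Ioo 0 R) :
    0 ≤ κ * X s - l * (s * Z s) := by
  refine nonneg_of_monotoneOn_of_integrableOn_div H.monotoneOn_flux ?_ hs
  refine ((H.integrableOn_combination (2 * κ)).const_mul (1 / 2)).congr (.of_forall fun s => ?_)
  simp only
  ring

/-- The derivative of `2F - X` is `(2|(κ - 1/2)a - ℓsb|² + (2κ² - 1/2)|a|²)/s + 2ℓ²sX`; the middle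
term is where `κ² ≥ 1/4` enters. A monotone quantity that is integrable against `ds/s` is
nonnegative. -/
lemma X_le_two_mul_flux (H : IsRadial κ l R X Y Z) (hκ : 1 / 4 ≤ κ ^ 2) {s : ℝ}
    (hs : s ∈ Set.Ioo 0 R) : X s ≤ 2 * (κ * X s - l * (s * Z s)) := by
  have hd : ∀ s ∈ Set.Ioo 0 R, HasDerivAt (fun s => 2 * (κ * X s - l * (s * Z s)) - X s) _ s :=
    fun s hs => ((H.hasDerivAt_flux hs).const_mul 2).sub (H.derivX s hs)
  have hm : MonotoneOn (fun s => 2 * (κ * X s - l * (s * Z s)) - X s) (Set.Ioo 0 R) := by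
    refine monotoneOn_of_deriv_nonneg (convex_Ioo 0 R)
      (fun s hs => (hd s hs).continuousAt.continuousWithinAt)
      (fun s hs => ?_) fun s hs => ?_ <;> rw [interior_Ioo] at hs
    · exact (hd s hs).differentiableAt.differentiableWithinAt
    · rw [(hd s hs).deriv]
      have hs0 := hs.1
      have h1 := H.pos s hs (κ - 1 / 2) (-(l * s))
      have hX := H.X_nonneg hs
      have h2 : 0 ≤ (2 * κ ^ 2 - 1 / 2) * X s := mul_nonneg (by linarith) hX
      have h3 : 0 ≤ 2 * l ^ 2 * s * X s := by positivity
      have h4 : 0 ≤ (2 * ((κ - 1 / 2) ^ 2 * X s + 2 * (κ - 1 / 2) * (-(l * s)) * Z s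
          + (-(l * s)) ^ 2 * Y s) + (2 * κ ^ 2 - 1 / 2) * X s) / s + 2 * l ^ 2 * s * X s :=
        add_nonneg (div_nonneg (by linarith) hs0.le) h3
      convert h4 using 1
      field_simp
      ring
  refine sub_nonneg.1 (nonneg_of_monotoneOn_of_integrableOn_div hm ?_ hs)
  refine (H.integrableOn_combination (2 * κ - 1)).congr (.of_forall fun s => ?_)
  simp only
  ring

/-- Since `2F = sX'`, the preceding bound reads `X ≤ sX'`. This encodes vanishing of order `1/2` at
the core. -/
lemma monotoneOn_X_div (H : IsRadial κ l R X Y Z) (hκ : 1 / 4 ≤ κ ^ 2) :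
    MonotoneOn (fun s => X s / s) (Set.Ioo 0 R) := by
  have hd : ∀ s ∈ Set.Ioo 0 R, HasDerivAt (fun s => X s / s) _ s :=
    fun s hs => (H.derivX s hs).div (hasDerivAt_id s) hs.1.ne'
  refine monotoneOn_of_deriv_nonneg (convex_Ioo 0 R)
    (fun s hs => (hd s hs).continuousAt.continuousWithinAt)
    (fun s hs => ?_) fun s hs => ?_ <;> rw [interior_Ioo] at hs
  · exact (hd s hs).differentiableAt.differentiableWithinAt
  · rw [(hd s hs).deriv]
    have hs0 := hs.1
    have h1 := H.X_le_two_mul_flux hκ hs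
    refine div_nonneg ?_ (sq_nonneg _)
    have : (2 * κ / s * X s - 2 * l * Z s) * s = 2 * (κ * X s - l * (s * Z s)) := by
      field_simp
    simp only [mul_one]
    linarith

lemma monotoneOn_X (H : IsRadial κ l R X Y Z) : MonotoneOn X (Set.Ioo 0 R) := by
  refine monotoneOn_of_deriv_nonneg (convex_Ioo 0 R)
    (fun s hs => (H.derivX s hs).continuousAt.continuousWithinAt)
    (fun s hs => ?_) fun s hs => ?_ <;> rw [interior_Ioo] at hs
  · exact (H.derivX s hs).differentiableAt.differentiableWithinAt
  · rw [(H.derivX s hs).deriv]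
    have hs0 := hs.1
    have h1 := H.flux_nonneg hs
    have : 2 * κ / s * X s - 2 * l * Z s = 2 * (κ * X s - l * (s * Z s)) / s := by
      field_simp
    rw [this]
    positivity

/-- On an interval of length `R/4` beyond `R/2`, `F' ≥ ℓ²sX ≥ ℓ²(R/2)X(R/2)`, and `F` starts
nonnegative. -/
lemma flux_growth (H : IsRadial κ l R X Y Z) (hR : 0 < R) :
    l ^ 2 * R ^ 2 / 8 * X (R / 2) ≤
      κ * X (3 * R / 4) - l * (3 * R / 4 * Z (3 * R / 4)) := by
  have h0 : R / 2 ∈ Set.Ioo 0 R := ⟨by linarith, by linarith⟩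
  have hsub : Set.Icc (R / 2) (3 * R / 4) ⊆ Set.Ioo 0 R :=
    fun x hx => ⟨by linarith [hx.1], by linarith [hx.2]⟩
  have key := Convex.mul_sub_le_image_sub_of_le_deriv (convex_Icc (R / 2) (3 * R / 4))
    (f := fun s => κ * X s - l * (s * Z s))
    (fun s hs => (H.hasDerivAt_flux (hsub hs)).continuousAt.continuousWithinAt)
    (fun s hs => (H.hasDerivAt_flux
      (hsub (interior_subset hs))).differentiableAt.differentiableWithinAt)
    (C := l ^ 2 * (R / 2) * X (R / 2)) (fun s hs => by
      have hs' := interior_subset hs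
      rw [(H.hasDerivAt_flux (hsub hs')).deriv]
      refine le_trans ?_ (H.flux_deriv_ge (hsub hs'))
      have := H.monotoneOn_X h0 (hsub hs') hs'.1
      have h5 := H.X_nonneg h0
      have := hs'.1
      have := (hsub hs').1
      gcongr)
    (R / 2) ⟨le_rfl, by linarith⟩ (3 * R / 4) ⟨by linarith, le_rfl⟩ (by linarith)
  have h1 := H.flux_nonneg h0
  linarith

/-- From `3R/4` on, `X' = 2F/s ≥ 2F(3R/4)/R`. Integrating over length `R/8` turns flux into size of
`X`, and leaves the last eighth of `(0, R)` for the `L²` norm. -/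
lemma sq_mul_X_half_le (H : IsRadial κ l R X Y Z) (hR : 0 < R) {s : ℝ}
    (hs : s ∈ Set.Ico (7 * R / 8) R) : l ^ 2 * R ^ 2 / 32 * X (R / 2) ≤ X s := by
  have h0 : R / 2 ∈ Set.Ioo 0 R := ⟨by linarith, by linarith⟩
  have h34 : 3 * R / 4 ∈ Set.Ioo 0 R := ⟨by linarith, by linarith⟩
  have hsub : Set.Icc (3 * R / 4) (7 * R / 8) ⊆ Set.Ioo 0 R :=
    fun x hx => ⟨by linarith [hx.1], by linarith [hx.2]⟩
  have hX := H.X_nonneg h0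
  have key := Convex.mul_sub_le_image_sub_of_le_deriv (convex_Icc (3 * R / 4) (7 * R / 8))
    (f := X) (fun s hs => (H.derivX s (hsub hs)).continuousAt.continuousWithinAt)
    (fun s hs => (H.derivX s
      (hsub (interior_subset hs))).differentiableAt.differentiableWithinAt)
    (C := 2 * (l ^ 2 * R ^ 2 / 8 * X (R / 2)) / R) (fun s hs => by
      have hs' := interior_subset hs
      have hs0 := (hsub hs').1
      rw [(H.derivX s (hsub hs')).deriv]
      have h1 := H.monotoneOn_flux h34 (hsub hs') hs'.1
      have h2 := H.flux_growth hR
      have : 2 * κ / s * X s - 2 * l * Z s = 2 * (κ * X s - l * (s * Z s)) / s := by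
        field_simp
      rw [this]
      simp only at h1
      have h3 := (hsub hs').2.le
      have h4 := h2.trans h1
      have h5 : 0 ≤ l ^ 2 * R ^ 2 / 8 * X (R / 2) := by positivity
      have h6 : 0 ≤ 2 * (κ * X s - l * (s * Z s)) := by linarith
      gcongr)
    (3 * R / 4) ⟨le_rfl, by linarith⟩ (7 * R / 8) ⟨by linarith, le_rfl⟩ (by linarith)
  have h1 := H.X_nonneg h34
  have h2 := H.monotoneOn_X (hsub ⟨by linarith, le_rfl⟩) ⟨by linarith [hs.1], hs.2⟩ hs.1
  have h3 : 2 * (l ^ 2 * R ^ 2 / 8 * X (R / 2)) / R * (7 * R / 8 - 3 * R / 4)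
      = l ^ 2 * R ^ 2 / 32 * X (R / 2) := by field_simp; ring
  linarith

/-- Write `sX = s²(X/s)` and compare `X/s` with its value at `R/2`. -/
lemma lintegral_le (H : IsRadial κ l R X Y Z) (hκ : 1 / 4 ≤ κ ^ 2) {r : ℝ} (hr : 0 < r)
    (hrR : r ≤ R / 2) :
    ∫⁻ s in Set.Ioo 0 r, ENNReal.ofReal (s * X s) ≤
      ENNReal.ofReal (2 * r ^ 3 / R * X (R / 2)) := by
  have h0 : R / 2 ∈ Set.Ioo 0 R := ⟨by linarith, by linarith⟩
  have hX := H.X_nonneg h0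
  calc ∫⁻ s in Set.Ioo 0 r, ENNReal.ofReal (s * X s)
      ≤ ∫⁻ s in Set.Ioo 0 r, ENNReal.ofReal (2 * r ^ 2 / R * X (R / 2)) := by
        refine setLIntegral_mono' measurableSet_Ioo fun s hs => ENNReal.ofReal_le_ofReal ?_
        have hs0 := hs.1
        have hsR : s ∈ Set.Ioo 0 R := ⟨hs0, by linarith [hs.2]⟩
        have h1 := H.monotoneOn_X_div hκ hsR h0 (by linarith [hs.2])
        have h2 := H.X_nonneg hsR
        simp only at h1
        have h3 := hs.2.le
        have hR : 0 < R := by linarith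
        calc s * X s = s ^ 2 * (X s / s) := by field_simp
          _ ≤ r ^ 2 * (X (R / 2) / (R / 2)) := by gcongr
          _ = _ := by field_simp
    _ = _ := by
        rw [setLIntegral_const, Real.volume_Ioo, ← ENNReal.ofReal_mul (by
          have hR : 0 < R := by linarith
          positivity)]
        congr 1
        ring

lemma X_half_le_lintegral (H : IsRadial κ l R X Y Z) (hR : 0 < R) :
    ENNReal.ofReal (R ^ 2 / 4 * X (R / 2)) ≤
      ∫⁻ s in Set.Ioo 0 R, ENNReal.ofReal (s * X s) := by
  have h0 : R / 2 ∈ Set.Ioo 0 R := ⟨by linarith, by linarith⟩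
  have hX := H.X_nonneg h0
  calc ENNReal.ofReal (R ^ 2 / 4 * X (R / 2))
      = ∫⁻ s in Set.Ioo (R / 2) R, ENNReal.ofReal (R / 2 * X (R / 2)) := by
        rw [setLIntegral_const, Real.volume_Ioo, ← ENNReal.ofReal_mul (by positivity)]
        congr 1
        ring
    _ ≤ ∫⁻ s in Set.Ioo (R / 2) R, ENNReal.ofReal (s * X s) := by
        refine setLIntegral_mono' measurableSet_Ioo fun s hs => ENNReal.ofReal_le_ofReal ?_
        have := H.monotoneOn_X h0 ⟨by linarith [hs.1], hs.2⟩ hs.1.le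
        have := hs.1
        have : 0 < s := by linarith
        gcongr
    _ ≤ _ := lintegral_mono_set (Set.Ioo_subset_Ioo_left (by linarith))

lemma sq_mul_X_half_le_lintegral (H : IsRadial κ l R X Y Z) (hR : 0 < R) :
    ENNReal.ofReal (l ^ 2 * R ^ 4 / 512 * X (R / 2)) ≤
      ∫⁻ s in Set.Ioo 0 R, ENNReal.ofReal (s * X s) := by
  have h0 : R / 2 ∈ Set.Ioo 0 R := ⟨by linarith, by linarith⟩
  have hX := H.X_nonneg h0
  calc ENNReal.ofReal (l ^ 2 * R ^ 4 / 512 * X (R / 2))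
      = ∫⁻ s in Set.Ioo (7 * R / 8) R,
          ENNReal.ofReal (R / 2 * (l ^ 2 * R ^ 2 / 32 * X (R / 2))) := by
        rw [setLIntegral_const, Real.volume_Ioo, ← ENNReal.ofReal_mul (by positivity)]
        congr 1
        ring
    _ ≤ ∫⁻ s in Set.Ioo (7 * R / 8) R, ENNReal.ofReal (s * X s) := by
        refine setLIntegral_mono' measurableSet_Ioo fun s hs => ENNReal.ofReal_le_ofReal ?_
        have := H.sq_mul_X_half_le hR ⟨hs.1.le, hs.2⟩
        have : R / 2 ≤ s := by linarith [hs.1]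
        gcongr
        · linarith
    _ ≤ _ := lintegral_mono_set (Set.Ioo_subset_Ioo_left (by linarith))

/-- The argument gives the constant `8`; `1024` is taken to agree with the estimate carrying `ℓ²`.
-/
lemma lintegral_decay (H : IsRadial κ l R X Y Z) (hκ : 1 / 4 ≤ κ ^ 2) {r : ℝ} (hr : 0 < r)
    (hrR : r ≤ R / 2) :
    ∫⁻ s in Set.Ioo 0 r, ENNReal.ofReal (s * X s) ≤
      ENNReal.ofReal (1024 * r ^ 3 / R ^ 3) * ∫⁻ s in Set.Ioo 0 R, ENNReal.ofReal (s * X s) := by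
  have hR : 0 < R := by linarith
  have hX := H.X_nonneg (s := R / 2) ⟨by linarith, by linarith⟩
  refine (H.lintegral_le hκ hr hrR).trans (le_trans ?_ (mul_le_mul_right
    (H.X_half_le_lintegral hR) _))
  rw [← ENNReal.ofReal_mul (by positivity)]
  apply ENNReal.ofReal_le_ofReal
  have : 1024 * r ^ 3 / R ^ 3 * (R ^ 2 / 4 * X (R / 2)) = 256 * r ^ 3 / R * X (R / 2) := by
    field_simp; ring
  rw [this]
  gcongr
  norm_num

lemma sq_mul_lintegral_decay (H : IsRadial κ l R X Y Z) (hκ : 1 / 4 ≤ κ ^ 2) {r : ℝ}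
    (hr : 0 < r) (hrR : r ≤ R / 2) :
    ENNReal.ofReal (l ^ 2) * ∫⁻ s in Set.Ioo 0 r, ENNReal.ofReal (s * X s) ≤
      ENNReal.ofReal (1024 * r ^ 3 / R ^ 5) * ∫⁻ s in Set.Ioo 0 R, ENNReal.ofReal (s * X s) := by
  have hR : 0 < R := by linarith
  have hX := H.X_nonneg (s := R / 2) ⟨by linarith, by linarith⟩
  refine (mul_le_mul_right (H.lintegral_le hκ hr hrR) _).trans (le_trans ?_ (mul_le_mul_right
    (H.sq_mul_X_half_le_lintegral hR) _))
  rw [← ENNReal.ofReal_mul (by positivity), ← ENNReal.ofReal_mul (by positivity)]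
  apply ENNReal.ofReal_le_ofReal
  apply le_of_eq
  field_simp
  ring

end IsRadial

/-! ### Parseval's identity for twisted Fourier coefficients -/

/-- Lebesgue measure on the period `(0, 2π)`. -/
noncomputable def circleMeasure : Measure ℝ := volume.restrict (Set.Ioo 0 (2 * Real.pi))

instance : IsFiniteMeasure circleMeasure := by
  unfold circleMeasure; infer_instance

/-- The character `x ↦ e^{-i k x}`. -/
noncomputable def char (k x : ℝ) : ℂ := Complex.exp (-(Complex.I * (k * x : ℝ)))

@[fun_prop] lemma continuous_char (k : ℝ) : Continuous (char k) := by
  unfold char; fun_prop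

@[simp] lemma norm_char (k x : ℝ) : ‖char k x‖ = 1 := by
  rw [char, ← mul_neg, ← Complex.ofReal_neg, mul_comm, Complex.norm_exp_ofReal_mul_I]

@[simp] lemma enorm_char (k x : ℝ) : ‖char k x‖ₑ = 1 := by
  rw [← ofReal_norm, norm_char, ENNReal.ofReal_one]

lemma char_add (k l x : ℝ) : char (k + l) x = char k x * char l x := by
  rw [char, char, char, ← Complex.exp_add]; congr 1; push_cast; ring

lemma circleMeasure_eq : circleMeasure = volume.restrict (Set.Ioc 0 (2 * Real.pi)) :=
  restrict_Ioo_eq_restrict_Ioc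

lemma integral_circleMeasure {E : Type*} [NormedAddCommGroup E] [NormedSpace ℝ E] (f : ℝ → E) :
    ∫ x, f x ∂circleMeasure = ∫ x in (0 : ℝ)..(2 * Real.pi), f x := by
  rw [circleMeasure_eq, intervalIntegral.integral_of_le Real.two_pi_pos.le]

lemma ofReal_integral_norm_sq {α E : Type*} [MeasurableSpace α] [NormedAddCommGroup E]
    {μ : Measure α} {f : α → E} (hf : MemLp f 2 μ) :
    ENNReal.ofReal (∫ x, ‖f x‖ ^ 2 ∂μ) = ∫⁻ x, ‖f x‖ₑ ^ 2 ∂μ := by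
  rw [ofReal_integral_eq_lintegral_ofReal
    ((memLp_two_iff_integrable_sq_norm hf.aestronglyMeasurable).1 hf)
    (.of_forall fun x => by positivity)]
  refine lintegral_congr fun x => ?_
  rw [ENNReal.ofReal_pow (norm_nonneg _), ofReal_norm]

/-- Twisting by the unimodular factor `char α` reduces this to ordinary Parseval; the factor `2π`
appears because the coefficients here are not averaged. -/
lemma tsum_enorm_sq_integral_char (α : ℝ) {f : ℝ → ℂ} (hf : MemLp f 2 circleMeasure) :
    ∑' n : ℤ, ‖∫ x, char (n + α) x * f x ∂circleMeasure‖ₑ ^ 2 =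
      ENNReal.ofReal (2 * Real.pi) * ∫⁻ x, ‖f x‖ₑ ^ 2 ∂circleMeasure := by
  have hpi := Real.two_pi_pos
  have hg : MemLp (fun x => char α x * f x) 2 circleMeasure :=
    hf.of_le ((continuous_char α).aestronglyMeasurable.mul hf.aestronglyMeasurable)
      (.of_forall fun x => by simp)
  have hs := hasSum_sq_fourierCoeffOn hpi (f := fun x => char α x * f x)
    (by rwa [← circleMeasure_eq])
  have hc : ∀ n : ℤ, fourierCoeffOn hpi (fun x => char α x * f x) n =
      (2 * Real.pi)⁻¹ • ∫ x, char (n + α) x * f x ∂circleMeasure := by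
    intro n
    rw [fourierCoeffOn_eq_integral, integral_circleMeasure, sub_zero, one_div]
    congr 1
    refine intervalIntegral.integral_congr fun x _ => ?_
    simp only [fourier_coe_apply, smul_eq_mul, char_add, ← mul_assoc]
    congr 2
    rw [char]
    congr 1
    have : (Real.pi : ℂ) ≠ 0 := by exact_mod_cast Real.pi_ne_zero
    push_cast
    field_simp
  have hs2 : HasSum (fun n : ℤ => ‖∫ x, char (n + α) x * f x ∂circleMeasure‖ ^ 2)
      (2 * Real.pi * ∫ x, ‖f x‖ ^ 2 ∂circleMeasure) := by
    convert! hs.mul_left ((2 * Real.pi) ^ 2) using 1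
    · funext n
      rw [hc, norm_smul, mul_pow, norm_inv, Real.norm_of_nonneg hpi.le]
      field_simp
    · rw [sub_zero, integral_circleMeasure, smul_eq_mul]
      simp only [norm_mul, norm_char, one_mul]
      field_simp
  have h3 := hs2.tsum_eq
  rw [← ofReal_integral_norm_sq hf, ← ENNReal.ofReal_mul hpi.le, ← h3,
    ENNReal.ofReal_tsum_of_nonneg (fun n => by positivity) hs2.summable]
  refine tsum_congr fun n => ?_
  rw [ENNReal.ofReal_pow (norm_nonneg _), ofReal_norm]

/-- Lebesgue measure on the square `(0, 2π)²`. -/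
noncomputable def torusMeasure : Measure (ℝ × ℝ) := circleMeasure.prod circleMeasure

instance : IsFiniteMeasure torusMeasure := by
  unfold torusMeasure; infer_instance

lemma ae_memLp_slice {α β E : Type*} [MeasurableSpace α] [MeasurableSpace β]
    [NormedAddCommGroup E] {μ : Measure α} {ν : Measure β} [SFinite μ] [SFinite ν]
    {f : α × β → E} (hf : MemLp f 2 (μ.prod ν)) :
    ∀ᵐ x ∂μ, MemLp (fun y => f (x, y)) 2 ν := by
  have h1 : Integrable (fun z => ‖f z‖ ^ 2) (μ.prod ν) :=
    (memLp_two_iff_integrable_sq_norm hf.aestronglyMeasurable).1 hf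
  filter_upwards [h1.prod_right_ae, hf.aestronglyMeasurable.prodMk_left] with x hx hx2
  exact (memLp_two_iff_integrable_sq_norm hx2).2 hx

lemma memLp_two_iff_lintegral {α E : Type*} [MeasurableSpace α] [NormedAddCommGroup E]
    {μ : Measure α} {f : α → E} (hf : AEStronglyMeasurable f μ) :
    MemLp f 2 μ ↔ ∫⁻ x, ‖f x‖ₑ ^ 2 ∂μ < ⊤ := by
  rw [MemLp, and_iff_right hf, eLpNorm_lt_top_iff_lintegral_rpow_enorm_lt_top (by simp) (by simp)]
  simp

/-- Twisted Fourier coefficients on the torus. -/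
noncomputable def torusCoeff (k l : ℝ) (f : ℝ × ℝ → ℂ) : ℂ :=
  ∫ z, char k z.1 * char l z.2 * f z ∂torusMeasure

lemma tsum_enorm_sq_torusCoeff (α β : ℝ) {f : ℝ × ℝ → ℂ} (hf : MemLp f 2 torusMeasure) :
    ∑' m : ℤ, ∑' n : ℤ, ‖torusCoeff (m + α) (n + β) f‖ₑ ^ 2 =
      ENNReal.ofReal (2 * Real.pi) ^ 2 * ∫⁻ z, ‖f z‖ₑ ^ 2 ∂torusMeasure := by
  set T := ENNReal.ofReal (2 * Real.pi)
  let g : ℤ → ℝ → ℂ := fun n x => ∫ y, char (n + β) y * f (x, y) ∂circleMeasure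
  have hgm : ∀ n, AEStronglyMeasurable (g n) circleMeasure := fun n =>
    AEStronglyMeasurable.integral_prod_right' (f := fun z : ℝ × ℝ => char (n + β) z.2 * f z)
      (((continuous_char _).comp continuous_snd).aestronglyMeasurable.mul hf.aestronglyMeasurable)
  -- Parseval in the second variable on almost every slice. It also shows that each `g n` is in
  -- `L²`, as Parseval in the first variable requires.
  have hpars : ∑' n : ℤ, ∫⁻ x, ‖g n x‖ₑ ^ 2 ∂circleMeasure =
      T * ∫⁻ z, ‖f z‖ₑ ^ 2 ∂torusMeasure := by
    rw [← lintegral_tsum fun n => (hgm n).enorm.pow_const 2, torusMeasure,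
      lintegral_prod _ (hf.aestronglyMeasurable.enorm.pow_const 2), ← lintegral_const_mul']
    · refine lintegral_congr_ae ?_
      filter_upwards [ae_memLp_slice hf] with x hx
      exact tsum_enorm_sq_integral_char β hx
    · exact ENNReal.ofReal_ne_top
  have hfin : T * ∫⁻ z, ‖f z‖ₑ ^ 2 ∂torusMeasure < ⊤ :=
    ENNReal.mul_lt_top ENNReal.ofReal_lt_top
      ((memLp_two_iff_lintegral hf.aestronglyMeasurable).1 hf)
  have hg : ∀ n, MemLp (g n) 2 circleMeasure := fun n =>
    (memLp_two_iff_lintegral (hgm n)).2 (((ENNReal.le_tsum n).trans hpars.le).trans_lt hfin)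
  have hcoeff : ∀ m n : ℤ, torusCoeff (m + α) (n + β) f =
      ∫ x, char (m + α) x * g n x ∂circleMeasure := by
    intro m n
    have hi : Integrable (fun z : ℝ × ℝ => char (m + α) z.1 * char (n + β) z.2 * f z)
        (circleMeasure.prod circleMeasure) := by
      refine (hf.integrable (by simp)).bdd_mul (c := 1) ?_ (.of_forall fun z => by simp)
      exact Continuous.aestronglyMeasurable (by fun_prop)
    rw [torusCoeff, torusMeasure, integral_prod _ hi]
    refine integral_congr_ae (.of_forall fun x => ?_)
    simp only [mul_assoc, g, integral_const_mul]
  simp_rw [hcoeff]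
  rw [ENNReal.tsum_comm]
  simp_rw [tsum_enorm_sq_integral_char α (hg _)]
  rw [ENNReal.tsum_mul_left, hpars, ← mul_assoc, sq]

/-! ### Fourier modes of functions on the tube -/

/-- The measure `r dr` on `(0, R)`. -/
noncomputable def radialMeasure (R : ℝ) : Measure ℝ :=
  (volume.restrict (Set.Ioo 0 R)).withDensity fun r => ENNReal.ofReal r

instance (R : ℝ) : IsFiniteMeasure (radialMeasure R) := by
  refine isFiniteMeasure_withDensity_ofReal ?_
  have : IntegrableOn (fun r : ℝ => r) (Set.Ioo 0 R) :=
    (continuous_id.integrableOn_Icc (a := 0) (b := R)).mono_set Set.Ioo_subset_Icc_self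
  exact this.2

lemma torusMeasure_eq : torusMeasure =
    volume.restrict (Set.Ioo 0 (2 * Real.pi) ×ˢ Set.Ioo 0 (2 * Real.pi)) := by
  rw [torusMeasure, circleMeasure, Measure.prod_restrict, Measure.volume_eq_prod]

lemma tubeMeasure_eq (R : ℝ) : tubeMeasure R = (radialMeasure R).prod torusMeasure := by
  rw [radialMeasure, prod_withDensity_left (by fun_prop), torusMeasure_eq,
    Measure.prod_restrict, tubeMeasure, Measure.volume_eq_prod]

lemma ae_radialMeasure_iff {R : ℝ} {p : ℝ → Prop} :
    (∀ᵐ s ∂radialMeasure R, p s) ↔ ∀ᵐ s ∂volume.restrict (Set.Ioo 0 R), p s := by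
  rw [radialMeasure, ae_withDensity_iff (by fun_prop)]
  constructor <;> intro h
  · filter_upwards [h, ae_restrict_mem measurableSet_Ioo] with s hs hs2
    exact hs (by simpa using hs2.1)
  · filter_upwards [h] with s hs _ using hs

lemma radialMeasure_mono {r R : ℝ} (h : r ≤ R) : radialMeasure r ≤ radialMeasure R := by
  have : radialMeasure r = (radialMeasure R).restrict (Set.Ioo 0 r) := by
    rw [radialMeasure, radialMeasure, restrict_withDensity measurableSet_Ioo,
      Measure.restrict_restrict measurableSet_Ioo,
      Set.inter_eq_left.2 (Set.Ioo_subset_Ioo_right h)]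
  rw [this]
  exact Measure.restrict_le_self

lemma tubeMeasure_mono {r R : ℝ} (h : r ≤ R) : tubeMeasure r ≤ tubeMeasure R := by
  rw [tubeMeasure_eq, tubeMeasure_eq]
  exact Measure.prod_mono (radialMeasure_mono h) le_rfl

instance (R : ℝ) : IsFiniteMeasure (tubeMeasure R) := by
  rw [tubeMeasure_eq]; infer_instance

/-- The Fourier mode `r ↦ ∫∫ e^{-ikθ - ilt} f(r, θ, t) dθ dt`. -/
noncomputable def mode (k l : ℝ) (f : Coord → ℂ) (r : ℝ) : ℂ :=
  torusCoeff k l fun z => f (r, z)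

lemma integrable_char_mul {f : ℝ × ℝ → ℂ} (k l : ℝ) (hf : Integrable f torusMeasure) :
    Integrable (fun z : ℝ × ℝ => char k z.1 * char l z.2 * f z) torusMeasure :=
  hf.bdd_mul (c := 1) (Continuous.aestronglyMeasurable (by fun_prop)) (.of_forall fun z => by simp)

lemma torusCoeff_congr {k l : ℝ} {f g : ℝ × ℝ → ℂ} (h : f =ᵐ[torusMeasure] g) :
    torusCoeff k l f = torusCoeff k l g := by
  refine integral_congr_ae ?_
  filter_upwards [h] with z hz
  rw [hz]

lemma torusCoeff_sub (k l : ℝ) {f g : ℝ × ℝ → ℂ} (hf : Integrable f torusMeasure)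
    (hg : Integrable g torusMeasure) :
    torusCoeff k l (fun z => f z - g z) = torusCoeff k l f - torusCoeff k l g := by
  rw [torusCoeff, torusCoeff, torusCoeff,
    ← integral_sub (integrable_char_mul k l hf) (integrable_char_mul k l hg)]
  simp only [mul_sub]

lemma torusCoeff_add (k l : ℝ) {f g : ℝ × ℝ → ℂ} (hf : Integrable f torusMeasure)
    (hg : Integrable g torusMeasure) :
    torusCoeff k l (fun z => f z + g z) = torusCoeff k l f + torusCoeff k l g := by
  rw [torusCoeff, torusCoeff, torusCoeff,
    ← integral_add (integrable_char_mul k l hf) (integrable_char_mul k l hg)]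
  simp only [mul_add]

lemma torusCoeff_const_mul (k l : ℝ) (c : ℂ) (f : ℝ × ℝ → ℂ) :
    torusCoeff k l (fun z => c * f z) = c * torusCoeff k l f := by
  rw [torusCoeff, torusCoeff, ← integral_const_mul]
  congr 1
  funext z
  ring

/-- This shift is how the factors `e^{∓iθ}` of the Dirac operator couple frequencies `κ` and `κ +
1`. -/
lemma torusCoeff_char_mul (k k' l : ℝ) (f : ℝ × ℝ → ℂ) :
    torusCoeff k l (fun z => char k' z.1 * f z) = torusCoeff (k + k') l f := by
  rw [torusCoeff, torusCoeff]
  congr 1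
  funext z
  rw [char_add]
  ring

section Mode

variable {R : ℝ} {k l : ℝ}

lemma aestronglyMeasurable_mode {f : Coord → ℂ} (hf : AEStronglyMeasurable f (tubeMeasure R)) :
    AEStronglyMeasurable (mode k l f) (radialMeasure R) := by
  rw [tubeMeasure_eq] at hf
  exact AEStronglyMeasurable.integral_prod_right'
    (f := fun p : Coord => char k p.2.1 * char l p.2.2 * f p)
    ((Continuous.aestronglyMeasurable (by fun_prop)).mul hf)

lemma eLpNorm_mode_le {f : Coord → ℂ} (hf : AEStronglyMeasurable f (tubeMeasure R)) :
    eLpNorm (mode k l f) 1 (radialMeasure R) ≤ eLpNorm f 1 (tubeMeasure R) := by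
  rw [tubeMeasure_eq] at *
  rw [eLpNorm_one_eq_lintegral_enorm, eLpNorm_one_eq_lintegral_enorm, lintegral_prod _ hf.enorm]
  refine lintegral_mono fun r => (enorm_integral_le_lintegral_enorm _).trans_eq ?_
  simp [enorm_mul]

lemma ae_integrable_slice {f : Coord → ℂ} (hf : Integrable f (tubeMeasure R)) :
    ∀ᵐ r ∂radialMeasure R, Integrable (fun z => f (r, z)) torusMeasure := by
  rw [tubeMeasure_eq] at hf
  exact hf.prod_right_ae

lemma mode_sub {f g : Coord → ℂ} (hf : Integrable f (tubeMeasure R))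
    (hg : Integrable g (tubeMeasure R)) :
    mode k l (f - g) =ᵐ[radialMeasure R] mode k l f - mode k l g := by
  filter_upwards [ae_integrable_slice hf, ae_integrable_slice hg] with r h1 h2
  exact torusCoeff_sub k l h1 h2

lemma integrable_mode {f : Coord → ℂ} (hf : Integrable f (tubeMeasure R)) :
    Integrable (mode k l f) (radialMeasure R) :=
  memLp_one_iff_integrable.1 ⟨aestronglyMeasurable_mode hf.1,
    (eLpNorm_mode_le hf.1).trans_lt (memLp_one_iff_integrable.2 hf).2⟩

lemma tendsto_mode {f : ℕ → Coord → ℂ} {g : Coord → ℂ} (hf : ∀ n, MemLp (f n) 2 (tubeMeasure R))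
    (hg : MemLp g 2 (tubeMeasure R))
    (h : Tendsto (fun n => eLpNorm (f n - g) 2 (tubeMeasure R)) atTop (𝓝 0)) :
    Tendsto (fun n => eLpNorm (mode k l (f n) - mode k l g) 1 (radialMeasure R)) atTop (𝓝 0) := by
  -- The tube has finite volume, so `L²` convergence implies `L¹` convergence, and taking a mode
  -- contracts `L¹` norms.
  have hC : tubeMeasure R Set.univ ^ (1 / (1 : ENNReal).toReal - 1 / (2 : ENNReal).toReal) ≠ ⊤ :=
    ENNReal.rpow_ne_top_of_nonneg (by norm_num) (measure_ne_top _ _)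
  have h2 := ENNReal.Tendsto.mul_const h (Or.inr hC)
  rw [zero_mul] at h2
  refine tendsto_of_tendsto_of_tendsto_of_le_of_le tendsto_const_nhds h2 (fun _ => zero_le)
    fun n => ?_
  have hm := ((hf n).sub hg).aestronglyMeasurable
  calc eLpNorm (mode k l (f n) - mode k l g) 1 (radialMeasure R)
      = eLpNorm (mode k l (f n - g)) 1 (radialMeasure R) :=
        eLpNorm_congr_ae (mode_sub ((hf n).integrable (by simp)) (hg.integrable (by simp))).symm
    _ ≤ _ := (eLpNorm_mode_le hm).trans
        (eLpNorm_le_eLpNorm_mul_rpow_measure_univ (by simp) hm)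

lemma tsum_lintegral_mode (α β : ℝ) {f : Coord → ℂ} (hf : MemLp f 2 (tubeMeasure R)) :
    ∑' m : ℤ, ∑' n : ℤ, ∫⁻ r, ‖mode (m + α) (n + β) f r‖ₑ ^ 2 ∂radialMeasure R =
      ENNReal.ofReal (2 * Real.pi) ^ 2 * ∫⁻ p, ‖f p‖ₑ ^ 2 ∂tubeMeasure R := by
  have hm : ∀ m n : ℤ, AEMeasurable (fun r => ‖mode (m + α) (n + β) f r‖ₑ ^ 2)
      (radialMeasure R) := fun m n =>
    (aestronglyMeasurable_mode hf.aestronglyMeasurable).enorm.pow_const 2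
  simp_rw [← fun m : ℤ => lintegral_tsum fun n : ℤ => hm m n]
  rw [← lintegral_tsum fun m => AEMeasurable.tsum fun n => hm m n]
  have hf' := hf
  rw [tubeMeasure_eq] at hf' ⊢
  rw [lintegral_prod _ (hf'.aestronglyMeasurable.enorm.pow_const 2),
    ← lintegral_const_mul' _ _ (by finiteness)]
  refine lintegral_congr_ae ?_
  filter_upwards [ae_memLp_slice hf'] with r hr
  exact tsum_enorm_sq_torusCoeff α β hr

end Mode

/-! ### Modes of smooth functions -/

lemma hasDerivAt_char (k x : ℝ) : HasDerivAt (char k) (-(Complex.I * k) * char k x) x := by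
  have h : HasDerivAt (fun x : ℝ => -(Complex.I * ((k * x : ℝ) : ℂ))) (-(Complex.I * k)) x := by
    simpa using (((hasDerivAt_id' x).const_mul k).ofReal_comp.const_mul Complex.I).fun_neg
  unfold char
  simpa [mul_comm] using h.cexp

/-- Integration by parts; `hper` cancels the boundary terms, the frequency `k` compensating the
monodromy of `g`. -/
lemma integral_char_mul_deriv {k : ℝ} {g g' : ℝ → ℂ} (hg : ∀ x, HasDerivAt g (g' x) x)
    (hg' : Continuous g') (hper : char k (2 * Real.pi) * g (2 * Real.pi) = g 0) :
    ∫ x, char k x * g' x ∂circleMeasure = Complex.I * k * ∫ x, char k x * g x ∂circleMeasure := by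
  have h := intervalIntegral.integral_mul_deriv_eq_deriv_mul (a := 0) (b := 2 * Real.pi)
    (fun x _ => hasDerivAt_char k x) (fun x _ => hg x)
    (Continuous.intervalIntegrable (by fun_prop) _ _) (hg'.intervalIntegrable _ _)
  have h0 : char k 0 = 1 := by simp [char]
  rw [integral_circleMeasure, integral_circleMeasure, h, hper, h0, one_mul, sub_self, zero_sub,
    ← intervalIntegral.integral_const_mul, ← intervalIntegral.integral_neg]
  refine intervalIntegral.integral_congr fun x _ => ?_
  ring

lemma integrable_torus_of_continuous {f : ℝ × ℝ → ℂ} (hf : Continuous f) :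
    Integrable f torusMeasure := by
  rw [torusMeasure_eq]
  have hK : IsCompact (Set.Icc 0 (2 * Real.pi) ×ˢ Set.Icc 0 (2 * Real.pi)) :=
    isCompact_Icc.prod isCompact_Icc
  have h : IntegrableOn f (Set.Icc 0 (2 * Real.pi) ×ˢ Set.Icc 0 (2 * Real.pi)) volume :=
    hf.continuousOn.integrableOn_compact hK
  exact h.mono_set (Set.prod_mono Set.Ioo_subset_Icc_self Set.Ioo_subset_Icc_self)

lemma torusCoeff_of_hasDerivAt_fst {k l : ℝ} {f f' : ℝ × ℝ → ℂ} (hf : Continuous f)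
    (hf' : Continuous f') (hd : ∀ x y, HasDerivAt (fun x => f (x, y)) (f' (x, y)) x)
    (hper : ∀ y, char k (2 * Real.pi) * f (2 * Real.pi, y) = f (0, y)) :
    torusCoeff k l f' = Complex.I * k * torusCoeff k l f := by
  have h1 := integrable_char_mul k l (integrable_torus_of_continuous hf)
  have h2 := integrable_char_mul k l (integrable_torus_of_continuous hf')
  rw [torusMeasure] at h1 h2
  rw [torusCoeff, torusCoeff, torusMeasure, integral_prod_symm _ h1, integral_prod_symm _ h2,
    ← integral_const_mul]
  congr 1
  funext y
  have := integral_char_mul_deriv (k := k) (fun x => hd x y) (by fun_prop) (hper y)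
  simp only [mul_comm (char k _) (char l y), mul_assoc, integral_const_mul] at this ⊢
  rw [this]
  ring

lemma torusCoeff_of_hasDerivAt_snd {k l : ℝ} {f f' : ℝ × ℝ → ℂ} (hf : Continuous f)
    (hf' : Continuous f') (hd : ∀ x y, HasDerivAt (fun y => f (x, y)) (f' (x, y)) y)
    (hper : ∀ x, char l (2 * Real.pi) * f (x, 2 * Real.pi) = f (x, 0)) :
    torusCoeff k l f' = Complex.I * l * torusCoeff k l f := by
  have h1 := integrable_char_mul k l (integrable_torus_of_continuous hf)
  have h2 := integrable_char_mul k l (integrable_torus_of_continuous hf')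
  rw [torusMeasure] at h1 h2
  rw [torusCoeff, torusCoeff, torusMeasure, integral_prod _ h1, integral_prod _ h2,
    ← integral_const_mul]
  congr 1
  funext x
  have := integral_char_mul_deriv (k := l) (fun y => hd x y) (by fun_prop) (hper x)
  simp only [mul_assoc, integral_const_mul] at this ⊢
  rw [this]
  ring

lemma mode_sub_mode_eq_integral {k l a b R : ℝ} {f f' : Coord → ℂ}
    (hf : ContinuousOn f (tube R)) (hf' : ContinuousOn f' (tube R))
    (hd : ∀ p ∈ tube R, HasDerivAt (fun s => f (s, p.2)) (f' p) p.1)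
    (ha : a ∈ Set.Ioo 0 R) (hb : b ∈ Set.Ioo 0 R) :
    mode k l f b - mode k l f a = ∫ s in a..b, mode k l f' s := by
  have hsub : Set.uIcc a b ⊆ Set.Ioo 0 R := Set.ordConnected_Ioo.uIcc_subset ha hb
  have hslice : ∀ {g : Coord → ℂ} {s}, ContinuousOn g (tube R) → s ∈ Set.Ioo 0 R →
      Continuous fun z => g (s, z) := fun hg hs =>
    continuousOn_univ.1 (hg.comp (by fun_prop) fun z _ => hs)
  have hint : Integrable (Function.uncurry fun s z => char k z.1 * char l z.2 * f' (s, z))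
      ((volume.restrict (Set.uIoc a b)).prod torusMeasure) := by
    rw [torusMeasure_eq, Measure.prod_restrict]
    have hc : ContinuousOn (Function.uncurry fun s (z : ℝ × ℝ) =>
        char k z.1 * char l z.2 * f' (s, z)) (tube R) := by
      refine ContinuousOn.mul (Continuous.continuousOn ?_) hf'
      exact ((continuous_char k).comp (by fun_prop)).mul ((continuous_char l).comp (by fun_prop))
    have hK : IsCompact (Set.uIcc a b ×ˢ
        (Set.Icc 0 (2 * Real.pi) ×ˢ Set.Icc 0 (2 * Real.pi))) :=
      isCompact_uIcc.prod (isCompact_Icc.prod isCompact_Icc)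
    have h : IntegrableOn (Function.uncurry fun s (z : ℝ × ℝ) =>
        char k z.1 * char l z.2 * f' (s, z)) (Set.uIcc a b ×ˢ
        (Set.Icc 0 (2 * Real.pi) ×ˢ Set.Icc 0 (2 * Real.pi))) volume :=
      (hc.mono fun p hp => hsub hp.1).integrableOn_compact hK
    exact h.mono_set (Set.prod_mono Set.uIoc_subset_uIcc
      (Set.prod_mono Set.Ioo_subset_Icc_self Set.Ioo_subset_Icc_self))
  unfold mode torusCoeff
  rw [intervalIntegral_integral_swap hint, ← integral_sub
    (integrable_char_mul k l (integrable_torus_of_continuous (hslice hf hb)))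
    (integrable_char_mul k l (integrable_torus_of_continuous (hslice hf ha)))]
  congr 1
  funext z
  rw [intervalIntegral.integral_const_mul, ← mul_sub]
  congr 1
  refine (intervalIntegral.integral_eq_sub_of_hasDerivAt
    (f := fun s => f (s, z)) (f' := fun s => f' (s, z)) (fun s hs => hd (s, z) (hsub hs)) ?_).symm
  refine ContinuousOn.intervalIntegrable (hf'.comp (by fun_prop) fun s hs => hsub hs)

/-! ### Limits in `L¹(r dr)` and the radial system -/

/-- Away from the core the density `r` is bounded below by `min a b`, so `L¹(r dr)` controls
ordinary integrals over `[a, b]`. -/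
lemma restrict_uIoc_le_smul_radialMeasure {a b R : ℝ} (ha : a ∈ Set.Ioo 0 R)
    (hb : b ∈ Set.Ioo 0 R) :
    volume.restrict (Set.uIoc a b) ≤ ENNReal.ofReal (min a b)⁻¹ • radialMeasure R := by
  have hm : 0 < min a b := lt_min ha.1 hb.1
  have hsub : Set.uIoc a b ⊆ Set.Ioo 0 R :=
    Set.uIoc_subset_uIcc.trans (Set.ordConnected_Ioo.uIcc_subset ha hb)
  refine Measure.le_iff.2 fun t ht => ?_
  rw [Measure.restrict_apply ht, Measure.smul_apply, smul_eq_mul, radialMeasure,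
    withDensity_apply _ ht, Measure.restrict_restrict ht, ← lintegral_const_mul' _ _ (by simp)]
  calc volume (t ∩ Set.uIoc a b) = ∫⁻ s in t ∩ Set.uIoc a b, 1 := by simp
    _ ≤ ∫⁻ s in t ∩ Set.uIoc a b, ENNReal.ofReal (min a b)⁻¹ * ENNReal.ofReal s := by
      refine setLIntegral_mono' (ht.inter measurableSet_uIoc) fun s hs => ?_
      rw [← ENNReal.ofReal_mul (by positivity), ← ENNReal.ofReal_one]
      apply ENNReal.ofReal_le_ofReal
      rw [← div_eq_inv_mul, one_le_div hm]
      exact hs.2.1.le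
    _ ≤ _ := lintegral_mono_set (Set.inter_subset_inter_right _ hsub)

lemma intervalIntegrable_of_integrable_radialMeasure {f : ℝ → ℂ} {a b R : ℝ}
    (hf : Integrable f (radialMeasure R)) (ha : a ∈ Set.Ioo 0 R) (hb : b ∈ Set.Ioo 0 R) :
    IntervalIntegrable f volume a b :=
  intervalIntegrable_iff.2
    ((hf.smul_measure ENNReal.ofReal_ne_top).mono_measure
      (restrict_uIoc_le_smul_radialMeasure ha hb))

lemma tendsto_intervalIntegral_of_tendsto_eLpNorm {f : ℕ → ℝ → ℂ} {g : ℝ → ℂ} {a b R : ℝ}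
    (hf : ∀ n, Integrable (f n) (radialMeasure R)) (hg : Integrable g (radialMeasure R))
    (h : Tendsto (fun n => eLpNorm (f n - g) 1 (radialMeasure R)) atTop (𝓝 0))
    (ha : a ∈ Set.Ioo 0 R) (hb : b ∈ Set.Ioo 0 R) :
    Tendsto (fun n => ∫ s in a..b, f n s) atTop (𝓝 (∫ s in a..b, g s)) := by
  have hle := restrict_uIoc_le_smul_radialMeasure ha hb
  have hi : ∀ {u : ℝ → ℂ}, Integrable u (radialMeasure R) → IntegrableOn u (Set.uIoc a b) :=
    fun hu => (hu.smul_measure ENNReal.ofReal_ne_top).mono_measure hle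
  simp_rw [intervalIntegral.intervalIntegral_eq_integral_uIoc]
  refine Tendsto.const_smul (tendsto_integral_of_L1' g (hi hg).1 (.of_forall fun n => hi (hf n)) ?_)
    _
  have h2 := ENNReal.Tendsto.const_mul (a := ENNReal.ofReal (min a b)⁻¹) h (Or.inr (by simp))
  rw [mul_zero] at h2
  refine tendsto_of_tendsto_of_tendsto_of_le_of_le tendsto_const_nhds h2 (fun _ => zero_le)
    fun n => ?_
  refine (eLpNorm_mono_measure _ hle).trans_eq ?_
  rw [eLpNorm_one_smul_measure]

lemma exists_subseq_tendsto_ae {f : ℕ → ℝ → ℂ} {g : ℝ → ℂ} {μ : Measure ℝ}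
    (hf : ∀ n, AEStronglyMeasurable (f n) μ) (hg : AEStronglyMeasurable g μ)
    (h : Tendsto (fun n => eLpNorm (f n - g) 1 μ) atTop (𝓝 0)) :
    ∃ ns : ℕ → ℕ, StrictMono ns ∧
      ∀ᵐ s ∂μ, Tendsto (fun i => f (ns i) s) atTop (𝓝 (g s)) :=
  (tendstoInMeasure_of_tendsto_eLpNorm one_ne_zero hf hg h).exists_seq_tendsto_ae

lemma exists_ae_eq_primitive {A A' : ℝ → ℂ} {f f' : ℕ → ℝ → ℂ} {R : ℝ} (hR : 0 < R)
    (hf : ∀ n, Integrable (f n) (radialMeasure R)) (hA : Integrable A (radialMeasure R))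
    (h : Tendsto (fun n => eLpNorm (f n - A) 1 (radialMeasure R)) atTop (𝓝 0))
    (hf' : ∀ n, Integrable (f' n) (radialMeasure R)) (hA' : Integrable A' (radialMeasure R))
    (h' : Tendsto (fun n => eLpNorm (f' n - A') 1 (radialMeasure R)) atTop (𝓝 0))
    (hftc : ∀ n, ∀ a ∈ Set.Ioo 0 R, ∀ b ∈ Set.Ioo 0 R, f n b - f n a = ∫ s in a..b, f' n s) :
    ∃ x ∈ Set.Ioo 0 R, ∃ c : ℂ,
      ∀ᵐ s ∂volume.restrict (Set.Ioo 0 R), A s = c + ∫ y in x..s, A' y := by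
  obtain ⟨ns, hns, hae⟩ := exists_subseq_tendsto_ae (fun n => (hf n).1) hA.1 h
  rw [ae_radialMeasure_iff] at hae
  have hne : (ae (volume.restrict (Set.Ioo 0 R))).NeBot := by
    rw [ae_neBot, Ne, Measure.restrict_eq_zero, Real.volume_Ioo]
    simpa using hR
  -- The base point must be one where the subsequence converges, so that the constant of integration
  -- passes to the limit.
  obtain ⟨x, hx, hxR⟩ := (hae.and (ae_restrict_mem measurableSet_Ioo)).exists
  refine ⟨x, hxR, A x, ?_⟩
  filter_upwards [hae, ae_restrict_mem measurableSet_Ioo] with s hs hsR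
  have h1 := hs.sub hx
  simp_rw [fun i => hftc (ns i) x hxR s hsR] at h1
  have h2 := (tendsto_intervalIntegral_of_tendsto_eLpNorm hf' hA' h' hxR hsR).comp hns.tendsto_atTop
  rw [← tendsto_nhds_unique h1 h2]
  ring

/-- Pointwise limits along a common subsequence are used because `φ` may be unbounded at the core,
as `k/s` is. -/
lemma ae_eq_mul_of_tendsto {F G : ℝ → ℂ} {f g : ℕ → ℝ → ℂ} {φ : ℝ → ℂ} {R : ℝ}
    (hf : ∀ n, Integrable (f n) (radialMeasure R)) (hF : Integrable F (radialMeasure R))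
    (h : Tendsto (fun n => eLpNorm (f n - F) 1 (radialMeasure R)) atTop (𝓝 0))
    (hg : ∀ n, Integrable (g n) (radialMeasure R)) (hG : Integrable G (radialMeasure R))
    (h' : Tendsto (fun n => eLpNorm (g n - G) 1 (radialMeasure R)) atTop (𝓝 0))
    (heq : ∀ n, ∀ s ∈ Set.Ioo 0 R, g n s = φ s * f n s) :
    ∀ᵐ s ∂volume.restrict (Set.Ioo 0 R), G s = φ s * F s := by
  obtain ⟨ns, hns, hae⟩ := exists_subseq_tendsto_ae (fun n => (hf n).1) hF.1 h
  obtain ⟨ms, hms, hae'⟩ := exists_subseq_tendsto_ae (fun n => (hg (ns n)).1) hG.1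
    (h'.comp hns.tendsto_atTop)
  rw [ae_radialMeasure_iff] at hae hae'
  filter_upwards [hae, hae', ae_restrict_mem measurableSet_Ioo] with s h1 h2 hs
  simp_rw [fun i => heq (ns (ms i)) s hs] at h2
  exact tendsto_nhds_unique h2 ((h1.comp hms.tendsto_atTop).const_mul (φ s))

lemma continuousOn_primitive_radial {A' : ℝ → ℂ} {R x : ℝ} (hA' : Integrable A' (radialMeasure R))
    (hx : x ∈ Set.Ioo 0 R) (c : ℂ) :
    ContinuousOn (fun s => c + ∫ y in x..s, A' y) (Set.Ioo 0 R) := by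
  intro s hs
  have hmin : 0 < min x s := lt_min hx.1 hs.1
  have hmax : max x s < R := max_lt hx.2 hs.2
  have h1 : min x s / 2 ∈ Set.Ioo 0 R :=
    ⟨by linarith, by linarith [min_le_left x s, hx.2]⟩
  have h2 : (max x s + R) / 2 ∈ Set.Ioo 0 R :=
    ⟨by linarith [le_max_left x s, hx.1, hx.2], by linarith⟩
  have hle : min x s / 2 ≤ (max x s + R) / 2 := by
    linarith [min_le_left x s, le_max_left x s, hx.1, hx.2]
  have h := intervalIntegral.continuousOn_primitive_interval' (a := x)
    (intervalIntegrable_of_integrable_radialMeasure hA' h1 h2) (by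
      rw [Set.uIcc_of_le hle]
      constructor
      · linarith [min_le_left x s]
      · linarith [le_max_left x s])
  rw [Set.uIcc_of_le hle] at h
  have hn : Set.Icc (min x s / 2) ((max x s + R) / 2) ∈ 𝓝 s :=
    Icc_mem_nhds (by linarith [min_le_right x s]) (by linarith [le_max_right x s])
  exact (continuousAt_const.add (h.continuousAt hn)).continuousWithinAt

lemma hasDerivAt_primitive_radial {A' g : ℝ → ℂ} {R x : ℝ} (hx : x ∈ Set.Ioo 0 R) (c : ℂ)
    (hg : ContinuousOn g (Set.Ioo 0 R))
    (h : ∀ᵐ s ∂volume.restrict (Set.Ioo 0 R), A' s = g s) {s : ℝ} (hs : s ∈ Set.Ioo 0 R) :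
    HasDerivAt (fun s => c + ∫ y in x..s, A' y) (g s) s := by
  have hsub : ∀ {t}, t ∈ Set.Ioo 0 R → Set.uIcc x t ⊆ Set.Ioo 0 R :=
    fun ht => Set.ordConnected_Ioo.uIcc_subset hx ht
  have heq : ∀ t ∈ Set.Ioo 0 R, ∫ y in x..t, A' y = ∫ y in x..t, g y := fun t ht =>
    intervalIntegral.integral_congr_ae_restrict
      (ae_restrict_of_ae_restrict_of_subset (Set.uIoc_subset_uIcc.trans (hsub ht)) h)
  have hd : HasDerivAt (fun s => c + ∫ y in x..s, g y) (g s) s :=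
    (intervalIntegral.integral_hasDerivAt_right (hg.mono (hsub hs)).intervalIntegrable
      (hg.stronglyMeasurableAtFilter isOpen_Ioo s hs)
      (hg.continuousAt (isOpen_Ioo.mem_nhds hs))).const_add c
  refine hd.congr_of_eventuallyEq ?_
  filter_upwards [isOpen_Ioo.mem_nhds hs] with t ht
  rw [heq t ht]

/-- `(a, b)` solves the radial system of the Dirac operator on `(0, R)`. -/
def SolvesRadial (κ l R : ℝ) (a b : ℝ → ℂ) : Prop :=
  ∀ s ∈ Set.Ioo 0 R, HasDerivAt a ((κ / s) • a s - l • b s) s ∧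
    HasDerivAt b ((-(κ + 1) / s) • b s - l • a s) s

lemma SolvesRadial.swap {κ l R : ℝ} {a b : ℝ → ℂ} (h : SolvesRadial κ l R a b) :
    SolvesRadial (-(κ + 1)) l R b a := by
  intro s hs
  refine ⟨(h s hs).2, ?_⟩
  convert! (h s hs).1 using 3
  ring

/-- Bootstrap: the primitives are continuous representatives, so the right-hand sides of the system
agree almost everywhere with continuous functions, and the primitives are then differentiable
everywhere. -/
lemma exists_solvesRadial {κ l R : ℝ} {A B A' B' : ℝ → ℂ}
    (hA' : Integrable A' (radialMeasure R)) (hB' : Integrable B' (radialMeasure R))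
    (hA : ∃ x ∈ Set.Ioo 0 R, ∃ c : ℂ,
      ∀ᵐ s ∂volume.restrict (Set.Ioo 0 R), A s = c + ∫ y in x..s, A' y)
    (hB : ∃ x ∈ Set.Ioo 0 R, ∃ c : ℂ,
      ∀ᵐ s ∂volume.restrict (Set.Ioo 0 R), B s = c + ∫ y in x..s, B' y)
    (hAB : ∀ᵐ s ∂volume.restrict (Set.Ioo 0 R), A' s = (κ / s) • A s - l • B s)
    (hBA : ∀ᵐ s ∂volume.restrict (Set.Ioo 0 R), B' s = (-(κ + 1) / s) • B s - l • A s) :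
    ∃ a b : ℝ → ℂ, A =ᵐ[volume.restrict (Set.Ioo 0 R)] a ∧
      B =ᵐ[volume.restrict (Set.Ioo 0 R)] b ∧ SolvesRadial κ l R a b := by
  obtain ⟨x, hx, c, hA⟩ := hA
  obtain ⟨y, hy, d, hB⟩ := hB
  have ha := continuousOn_primitive_radial hA' hx c
  have hb := continuousOn_primitive_radial hB' hy d
  have hdiv : ∀ k : ℝ, ContinuousOn (fun s => k / s) (Set.Ioo 0 R) := fun k =>
    continuousOn_const.div continuousOn_id fun s hs => hs.1.ne'
  refine ⟨_, _, hA, hB, fun s hs => ⟨?_, ?_⟩⟩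
  · refine hasDerivAt_primitive_radial hx c
      (g := fun s => (κ / s) • (c + ∫ y in x..s, A' y) - l • (d + ∫ z in y..s, B' z))
      (((hdiv κ).smul ha).sub (hb.const_smul l)) ?_ hs
    filter_upwards [hAB, hA, hB] with s h1 h2 h3
    rw [h1, h2, h3]
  · refine hasDerivAt_primitive_radial hy d
      (g := fun s => (-(κ + 1) / s) • (d + ∫ z in y..s, B' z) - l • (c + ∫ y in x..s, A' y))
      (((hdiv _).smul hb).sub (ha.const_smul l)) ?_ hs
    filter_upwards [hBA, hA, hB] with s h1 h2 h3
    rw [h1, h2, h3]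

lemma SolvesRadial.isRadial {κ l R : ℝ} {a b : ℝ → ℂ} (h : SolvesRadial κ l R a b)
    (hi : IntegrableOn (fun s => (‖a s‖ ^ 2 + ‖b s‖ ^ 2) / s) (Set.Ioo 0 R)) :
    IsRadial κ l R (fun s => ‖a s‖ ^ 2) (fun s => ‖b s‖ ^ 2) (fun s => inner ℝ (a s) (b s)) where
  derivX s hs := by
    refine (h s hs).1.norm_sq.congr_deriv ?_
    rw [inner_sub_right, inner_smul_right, inner_smul_right, real_inner_self_eq_norm_sq]
    ring
  derivZ s hs := by
    refine ((h s hs).1.inner ℝ (h s hs).2).congr_deriv ?_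
    simp only [inner_sub_right, inner_sub_left, real_inner_smul_left, real_inner_smul_right,
      real_inner_self_eq_norm_sq]
    have := hs.1.ne'
    field_simp
    ring
  pos s _ α β := by
    have h1 := norm_add_sq_real (α • a s) (β • b s)
    rw [real_inner_smul_left, real_inner_smul_right, norm_smul, norm_smul, mul_pow, mul_pow,
      Real.norm_eq_abs, Real.norm_eq_abs, sq_abs, sq_abs] at h1
    have h2 := sq_nonneg ‖α • a s + β • b s‖
    linarith
  integrable := hi

lemma lintegral_radialMeasure {A a : ℝ → ℂ} {R r : ℝ} (hr : r ≤ R)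
    (h : A =ᵐ[volume.restrict (Set.Ioo 0 R)] a) :
    ∫⁻ s, ‖A s‖ₑ ^ 2 ∂radialMeasure r =
      ∫⁻ s in Set.Ioo 0 r, ENNReal.ofReal (s * ‖a s‖ ^ 2) := by
  rw [radialMeasure, lintegral_withDensity_eq_lintegral_mul_non_measurable _ (by fun_prop)
    (.of_forall fun _ => ENNReal.ofReal_lt_top)]
  refine lintegral_congr_ae ?_
  filter_upwards [ae_restrict_of_ae_restrict_of_subset (Set.Ioo_subset_Ioo_right hr) h,
    ae_restrict_mem measurableSet_Ioo] with s hs hs0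
  rw [Pi.mul_apply, hs, ENNReal.ofReal_mul hs0.1.le, ENNReal.ofReal_pow (norm_nonneg _),
    ofReal_norm]

/-! ### Modes of sections in `L²₁` -/

lemma isOpen_tube (R : ℝ) : IsOpen (tube R) :=
  (isOpen_lt continuous_const continuous_fst).inter (isOpen_lt continuous_fst continuous_const)

lemma memLp_apply {f : Coord → Spinor} {μ : Measure Coord} (hf : MemLp f 2 μ) (j : Fin 2) :
    MemLp (fun p => f p j) 2 μ :=
  memLp_piLp_iff.1 hf j

lemma tendsto_eLpNorm_apply {f : ℕ → Coord → Spinor} {g : Coord → Spinor} {μ : Measure Coord}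
    (h : Tendsto (fun n => eLpNorm (f n - g) 2 μ) atTop (𝓝 0)) (j : Fin 2) :
    Tendsto (fun n => eLpNorm ((fun p => f n p j) - fun p => g p j) 2 μ) atTop (𝓝 0) :=
  tendsto_of_tendsto_of_tendsto_of_le_of_le tendsto_const_nhds h (fun _ => zero_le)
    fun n => eLpNorm_mono fun p => PiLp.norm_apply_le (f n p - g p) j

section Smooth

variable {ε : ℤˣ} {R : ℝ} {u : Coord → Spinor}

lemma IsSmoothLTwoOne.hasFDerivAt (hu : IsSmoothLTwoOne ε R u) {p : Coord} (hp : p ∈ tube R) :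
    HasFDerivAt u (fderiv ℝ u p) p :=
  ((hu.smooth.contDiffAt ((isOpen_tube R).mem_nhds hp)).differentiableAt (by simp)).hasFDerivAt

lemma IsSmoothLTwoOne.hasDerivAt_comp (hu : IsSmoothLTwoOne ε R u) {p w : Coord}
    {c : ℝ → Coord} {x : ℝ} (hp : p ∈ tube R)
    (hx : c x = p) (hc : HasDerivAt c w x) (j : Fin 2) :
    HasDerivAt (fun x => u (c x) j) (fderiv ℝ u p w j) x := by
  subst hx
  have h := (hu.hasFDerivAt hp).comp_hasDerivAt x hc
  exact ((EuclideanSpace.proj (𝕜 := ℂ) j).restrictScalars ℝ).hasFDerivAt.comp_hasDerivAt x h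

lemma IsSmoothLTwoOne.continuousOn_apply (hu : IsSmoothLTwoOne ε R u) (j : Fin 2) :
    ContinuousOn (fun p => u p j) (tube R) :=
  (EuclideanSpace.proj (𝕜 := ℂ) j : Spinor →L[ℂ] ℂ).continuous.comp_continuousOn
    hu.smooth.continuousOn

lemma IsSmoothLTwoOne.continuousOn_fderiv_apply (hu : IsSmoothLTwoOne ε R u) (w : Coord)
    (j : Fin 2) : ContinuousOn (fun p => fderiv ℝ u p w j) (tube R) :=
  (EuclideanSpace.proj (𝕜 := ℂ) j : Spinor →L[ℂ] ℂ).continuous.comp_continuousOn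
    ((hu.smooth.continuousOn_fderiv_of_isOpen (isOpen_tube R) (by simp)).clm_apply
      continuousOn_const)

lemma IsSmoothLTwoOne.mode_sub_mode (hu : IsSmoothLTwoOne ε R u) (k l : ℝ) (j : Fin 2)
    {a b : ℝ} (ha : a ∈ Set.Ioo 0 R)
    (hb : b ∈ Set.Ioo 0 R) :
    mode k l (fun p => u p j) b - mode k l (fun p => u p j) a =
      ∫ s in a..b, mode k l (fun p => grad u 0 p j) s := by
  refine mode_sub_mode_eq_integral (hu.continuousOn_apply j)
    (hu.continuousOn_fderiv_apply (1, 0, 0) j) (fun p hp => ?_) ha hb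
  refine hu.hasDerivAt_comp (c := fun s => (s, p.2)) hp rfl ?_ j
  exact (hasDerivAt_id' _).prodMk (hasDerivAt_const _ _)

lemma continuous_slice_of_continuousOn {g : Coord → ℂ} (hg : ContinuousOn g (tube R)) {s : ℝ}
    (hs : s ∈ Set.Ioo 0 R) : Continuous fun z => g (s, z) := by
  exact continuousOn_univ.1 (hg.comp (by fun_prop) fun z _ => hs)

lemma IsSmoothLTwoOne.mode_grad_one (hu : IsSmoothLTwoOne ε R u) {k : ℝ} (l : ℝ)
    (hk : char k (2 * Real.pi) = -1) (j : Fin 2) {s : ℝ} (hs : s ∈ Set.Ioo 0 R) :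
    mode k l (fun p => grad u 1 p j) s =
      Complex.I * (k / s : ℝ) * mode k l (fun p => u p j) s := by
  have h := torusCoeff_of_hasDerivAt_fst (k := k) (l := l) (f := fun z => u (s, z) j)
    (f' := fun z => fderiv ℝ u (s, z) (0, 1, 0) j)
    (continuous_slice_of_continuousOn (hu.continuousOn_apply j) hs)
    (continuous_slice_of_continuousOn (hu.continuousOn_fderiv_apply (0, 1, 0) j) hs)
    (fun x y => hu.hasDerivAt_comp (c := fun x => (s, x, y)) (p := (s, x, y)) hs rfl
      ((hasDerivAt_const _ _).prodMk ((hasDerivAt_id' _).prodMk (hasDerivAt_const _ _))) j)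
    (fun y => by
      have := (hu.isSection s 0 y hs).1
      rw [zero_add] at this
      rw [this, hk]
      simp)
  have h2 : mode k l (fun p => grad u 1 p j) s =
      torusCoeff k l fun z => ((s⁻¹ : ℝ) : ℂ) * fderiv ℝ u (s, z) (0, 1, 0) j := by
    unfold mode
    simp [grad]
  rw [h2, torusCoeff_const_mul, h, mode]
  push_cast
  ring

lemma IsSmoothLTwoOne.mode_grad_two (hu : IsSmoothLTwoOne ε R u) (k : ℝ) {l : ℝ}
    (hl : char l (2 * Real.pi) * ((ε : ℤ) : ℂ) = 1) (j : Fin 2) {s : ℝ} (hs : s ∈ Set.Ioo 0 R) :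
    mode k l (fun p => grad u 2 p j) s = Complex.I * l * mode k l (fun p => u p j) s := by
  refine torusCoeff_of_hasDerivAt_snd (k := k) (l := l) (f := fun z => u (s, z) j)
    (f' := fun z => fderiv ℝ u (s, z) (0, 0, 1) j)
    (continuous_slice_of_continuousOn (hu.continuousOn_apply j) hs)
    (continuous_slice_of_continuousOn (hu.continuousOn_fderiv_apply (0, 0, 1) j) hs)
    (fun x y => hu.hasDerivAt_comp (c := fun y => (s, x, y)) (p := (s, x, y)) hs rfl
      ((hasDerivAt_const _ _).prodMk ((hasDerivAt_const _ _).prodMk (hasDerivAt_id' _))) j)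
    (fun x => by
      have := (hu.isSection s x 0 hs).2
      rw [zero_add] at this
      rw [this, PiLp.smul_apply, smul_eq_mul, ← mul_assoc, hl, one_mul])

end Smooth

section Limit

variable {ε : ℤˣ} {R : ℝ} {v : Coord → Spinor} {G : Fin 3 → Coord → Spinor}

lemma integrable_mode_apply {f : Coord → Spinor} (hf : MemLp f 2 (tubeMeasure R)) (k l : ℝ)
    (j : Fin 2) : Integrable (mode k l fun p => f p j) (radialMeasure R) :=
  integrable_mode ((memLp_apply hf j).integrable (by simp))

lemma HasLTwoOneGrad.exists_primitive_mode (H : HasLTwoOneGrad ε R v G) (hR : 0 < R) (k l : ℝ)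
    (j : Fin 2) : ∃ x ∈ Set.Ioo 0 R, ∃ c : ℂ, ∀ᵐ s ∂volume.restrict (Set.Ioo 0 R),
      mode k l (fun p => v p j) s = c + ∫ y in x..s, mode k l (fun p => G 0 p j) y := by
  obtain ⟨u, hu, huv, hgrad⟩ := H.approx
  exact exists_ae_eq_primitive hR (fun n => integrable_mode_apply (hu n).memLp k l j)
    (integrable_mode_apply H.memLp k l j)
    (tendsto_mode (fun n => memLp_apply (hu n).memLp j) (memLp_apply H.memLp j)
      (tendsto_eLpNorm_apply huv j))
    (fun n => integrable_mode_apply ((hu n).memLp_grad 0) k l j)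
    (integrable_mode_apply (H.memLp_grad 0) k l j)
    (tendsto_mode (fun n => memLp_apply ((hu n).memLp_grad 0) j) (memLp_apply (H.memLp_grad 0) j)
      (tendsto_eLpNorm_apply (hgrad 0) j))
    fun n a ha b hb => (hu n).mode_sub_mode k l j ha hb

lemma HasLTwoOneGrad.mode_eq_mul (H : HasLTwoOneGrad ε R v G) {k l : ℝ} {j : Fin 2} {i : Fin 3}
    {φ : ℝ → ℂ} (hφ : ∀ u, IsSmoothLTwoOne ε R u → ∀ s ∈ Set.Ioo 0 R,
      mode k l (fun p => grad u i p j) s = φ s * mode k l (fun p => u p j) s) :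
    ∀ᵐ s ∂volume.restrict (Set.Ioo 0 R),
      mode k l (fun p => G i p j) s = φ s * mode k l (fun p => v p j) s := by
  obtain ⟨u, hu, huv, hgrad⟩ := H.approx
  exact ae_eq_mul_of_tendsto (fun n => integrable_mode_apply (hu n).memLp k l j)
    (integrable_mode_apply H.memLp k l j)
    (tendsto_mode (fun n => memLp_apply (hu n).memLp j) (memLp_apply H.memLp j)
      (tendsto_eLpNorm_apply huv j))
    (fun n => integrable_mode_apply ((hu n).memLp_grad i) k l j)
    (integrable_mode_apply (H.memLp_grad i) k l j)
    (tendsto_mode (fun n => memLp_apply ((hu n).memLp_grad i) j) (memLp_apply (H.memLp_grad i) j)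
      (tendsto_eLpNorm_apply (hgrad i) j))
    fun n s hs => hφ (u n) (hu n) s hs

lemma HasLTwoOneGrad.mode_grad_one (H : HasLTwoOneGrad ε R v G) {k : ℝ} (l : ℝ)
    (hk : char k (2 * Real.pi) = -1) (j : Fin 2) : ∀ᵐ s ∂volume.restrict (Set.Ioo 0 R),
      mode k l (fun p => G 1 p j) s = Complex.I * (k / s : ℝ) * mode k l (fun p => v p j) s :=
  H.mode_eq_mul (φ := fun s => Complex.I * (k / s : ℝ)) fun _ hu _ hs => hu.mode_grad_one l hk j hs

lemma HasLTwoOneGrad.mode_grad_two (H : HasLTwoOneGrad ε R v G) (k : ℝ) {l : ℝ}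
    (hl : char l (2 * Real.pi) * ((ε : ℤ) : ℂ) = 1) (j : Fin 2) :
    ∀ᵐ s ∂volume.restrict (Set.Ioo 0 R),
      mode k l (fun p => G 2 p j) s = Complex.I * l * mode k l (fun p => v p j) s :=
  H.mode_eq_mul (φ := fun _ => Complex.I * l) fun _ hu _ hs => hu.mode_grad_two k hl j hs

end Limit

/-! ### The Dirac equation for the modes -/

section Dirac

variable {ε : ℤˣ} {R : ℝ} {v : Coord → Spinor} {G : Fin 3 → Coord → Spinor}

lemma dirac_eq_zero_iff {p : Coord} : dirac G p = 0 ↔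
    char 1 p.2.1 * (G 0 p 1 - Complex.I * G 1 p 1) = Complex.I * G 2 p 0 ∧
    char (-1) p.2.1 * (G 0 p 0 + Complex.I * G 1 p 0) = Complex.I * G 2 p 1 := by
  have h1 : Complex.exp (-(Complex.I * (p.2.1 : ℂ))) = char 1 p.2.1 := by simp [char]
  have h2 : Complex.exp (Complex.I * (p.2.1 : ℂ)) = char (-1) p.2.1 := by simp [char]
  rw [funext_iff, Fin.forall_fin_two, dirac, h1, h2]
  simp only [eOne, eTwo, eThree, Pi.add_apply, Matrix.mulVec, dotProduct, Fin.sum_univ_two,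
    PiLp.smul_apply, PiLp.sub_apply, PiLp.add_apply, smul_eq_mul, Matrix.of_apply,
    Matrix.cons_val', Matrix.cons_val_zero, Matrix.cons_val_one, Matrix.cons_val_fin_one,
    Pi.zero_apply]
  constructor
  · rintro ⟨ha, hb⟩
    exact ⟨by linear_combination ha, by linear_combination -hb⟩
  · rintro ⟨ha, hb⟩
    exact ⟨by linear_combination ha, by linear_combination -hb⟩

/-- The Dirac equation is integrated against characters slice by slice; only the algebra of
coefficients is involved, no differentiation. -/
lemma mode_dirac (hG : ∀ i, MemLp (G i) 2 (tubeMeasure R))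
    (hD : ∀ᵐ p ∂tubeMeasure R, dirac G p = 0) (κ l : ℝ) :
    ∀ᵐ s ∂volume.restrict (Set.Ioo 0 R),
      mode (κ + 1) l (fun p => G 0 p 1) s - Complex.I * mode (κ + 1) l (fun p => G 1 p 1) s =
        Complex.I * mode κ l (fun p => G 2 p 0) s ∧
      mode κ l (fun p => G 0 p 0) s + Complex.I * mode κ l (fun p => G 1 p 0) s =
        Complex.I * mode (κ + 1) l (fun p => G 2 p 1) s := by
  have hint : ∀ i j, ∀ᵐ s ∂radialMeasure R, Integrable (fun z => G i (s, z) j) torusMeasure :=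
    fun i j => ae_integrable_slice (f := fun p => G i p j) ((memLp_apply (hG i) j).integrable (by simp))
  rw [tubeMeasure_eq] at hD
  rw [← ae_radialMeasure_iff]
  filter_upwards [hint 0 0, hint 0 1, hint 1 0, hint 1 1,
    Measure.ae_ae_of_ae_prod hD] with s h00 h01 h10 h11 hs
  unfold mode
  constructor
  · rw [← torusCoeff_const_mul, ← torusCoeff_const_mul, ← torusCoeff_sub _ _ h01 (h11.const_mul _),
      ← torusCoeff_char_mul]
    refine torusCoeff_congr ?_
    filter_upwards [hs] with z hz
    rw [(dirac_eq_zero_iff.1 hz).1]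
  · have hκ : κ = (κ + 1) + -1 := by ring
    rw [← torusCoeff_const_mul, ← torusCoeff_const_mul, ← torusCoeff_add _ _ h00 (h10.const_mul _)]
    conv_lhs => rw [hκ]
    rw [← torusCoeff_char_mul]
    refine torusCoeff_congr ?_
    filter_upwards [hs] with z hz
    rw [(dirac_eq_zero_iff.1 hz).2]

lemma lintegral_mode_lt_top {f : Coord → ℂ} (hf : MemLp f 2 (tubeMeasure R)) (k l : ℝ) :
    ∫⁻ s, ‖mode k l f s‖ₑ ^ 2 ∂radialMeasure R < ⊤ := by
  have h := tsum_lintegral_mode k l hf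
  have h2 : ENNReal.ofReal (2 * Real.pi) ^ 2 * ∫⁻ p, ‖f p‖ₑ ^ 2 ∂tubeMeasure R < ⊤ :=
    ENNReal.mul_lt_top (by finiteness) ((memLp_two_iff_lintegral hf.aestronglyMeasurable).1 hf)
  rw [← h] at h2
  refine lt_of_le_of_lt ?_ h2
  -- A single mode is the term with both indices `0` in Parseval's sum twisted by `(k, l)`.
  have h3 := (ENNReal.le_tsum (f := fun n : ℤ =>
    ∫⁻ r, ‖mode ((0 : ℤ) + k) (n + l) f r‖ₑ ^ 2 ∂radialMeasure R) 0).trans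
    (ENNReal.le_tsum (f := fun m : ℤ => ∑' n : ℤ,
    ∫⁻ r, ‖mode (m + k) (n + l) f r‖ₑ ^ 2 ∂radialMeasure R) 0)
  simpa using h3

/-- Regularity at the core: `B` is the mode of `r⁻¹∂_θ v`, and `s|ik/s · a|² = k²|a|²/s`. -/
lemma integrableOn_sq_div {k : ℝ} (hk : k ≠ 0) {A B a : ℝ → ℂ}
    (hA : A =ᵐ[volume.restrict (Set.Ioo 0 R)] a) (ha : ContinuousOn a (Set.Ioo 0 R))
    (hB : ∫⁻ s, ‖B s‖ₑ ^ 2 ∂radialMeasure R < ⊤)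
    (hAB : ∀ᵐ s ∂volume.restrict (Set.Ioo 0 R), B s = Complex.I * (k / s : ℝ) * A s) :
    IntegrableOn (fun s => ‖a s‖ ^ 2 / s) (Set.Ioo 0 R) := by
  have hB' : B =ᵐ[volume.restrict (Set.Ioo 0 R)] fun s => Complex.I * (k / s : ℝ) * a s := by
    filter_upwards [hA, hAB] with s h1 h2
    rw [h2, h1]
  rw [lintegral_radialMeasure le_rfl hB'] at hB
  have hm : ContinuousOn (fun s => s * ‖Complex.I * (k / s : ℝ) * a s‖ ^ 2) (Set.Ioo 0 R) := by
    refine continuousOn_id.mul (ContinuousOn.pow (ContinuousOn.norm (ContinuousOn.mul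
      (continuousOn_const.mul (Complex.continuous_ofReal.comp_continuousOn ?_)) ha)) 2)
    exact continuousOn_const.div continuousOn_id fun s hs => hs.1.ne'
  have hi : IntegrableOn (fun s => s * ‖Complex.I * (k / s : ℝ) * a s‖ ^ 2) (Set.Ioo 0 R) := by
    refine ⟨hm.aestronglyMeasurable measurableSet_Ioo, ?_⟩
    rw [hasFiniteIntegral_iff_ofReal]
    · exact hB
    · filter_upwards [ae_restrict_mem measurableSet_Ioo] with s hs
      have := hs.1
      simp only [Pi.zero_apply]
      positivity
  refine (hi.const_mul (k ^ 2)⁻¹).congr ?_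
  filter_upwards [ae_restrict_mem measurableSet_Ioo] with s hs
  have := hs.1.ne'
  rw [norm_mul, norm_mul, Complex.norm_I, Complex.norm_real, Real.norm_eq_abs, mul_pow, mul_pow,
    sq_abs]
  field_simp

/-- The modes of a solution of the Dirac equation solve the radial system. -/
lemma HasLTwoOneGrad.exists_isRadial (H : HasLTwoOneGrad ε R v G)
    (hD : ∀ᵐ p ∂tubeMeasure R, dirac G p = 0) (hR : 0 < R) {κ l : ℝ}
    (hκ : char κ (2 * Real.pi) = -1) (hκ' : char (κ + 1) (2 * Real.pi) = -1)
    (h0 : κ ≠ 0) (h1 : κ + 1 ≠ 0) (hl : char l (2 * Real.pi) * ((ε : ℤ) : ℂ) = 1) :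
    ∃ (a b : ℝ → ℂ) (Z : ℝ → ℝ),
      mode κ l (fun p => v p 0) =ᵐ[volume.restrict (Set.Ioo 0 R)] a ∧
      mode (κ + 1) l (fun p => v p 1) =ᵐ[volume.restrict (Set.Ioo 0 R)] b ∧
      IsRadial κ l R (fun s => ‖a s‖ ^ 2) (fun s => ‖b s‖ ^ 2) Z ∧
      IsRadial (-(κ + 1)) l R (fun s => ‖b s‖ ^ 2) (fun s => ‖a s‖ ^ 2) Z := by
  have hA1 := H.mode_grad_one l hκ 0
  have hB1 := H.mode_grad_one l hκ' 1
  obtain ⟨a, b, hA, hB, hab⟩ := exists_solvesRadial (κ := κ) (l := l)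
    (integrable_mode_apply (H.memLp_grad 0) κ l 0)
    (integrable_mode_apply (H.memLp_grad 0) (κ + 1) l 1)
    (H.exists_primitive_mode hR κ l 0) (H.exists_primitive_mode hR (κ + 1) l 1)
    (by
      filter_upwards [mode_dirac H.memLp_grad hD κ l, hA1, H.mode_grad_two (κ + 1) hl 1]
        with s hs h2 h3
      have h4 := hs.2
      rw [h2, h3] at h4
      rw [Complex.real_smul, Complex.real_smul]
      linear_combination h4 + (l * mode (κ + 1) l (fun p => v p 1) s
        - (κ / s : ℝ) * mode κ l (fun p => v p 0) s) * Complex.I_mul_I)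
    (by
      filter_upwards [mode_dirac H.memLp_grad hD κ l, hB1, H.mode_grad_two κ hl 0]
        with s hs h2 h3
      have h4 := hs.1
      rw [h2, h3] at h4
      rw [Complex.real_smul, Complex.real_smul, neg_div, Complex.ofReal_neg]
      linear_combination h4 + (l * mode κ l (fun p => v p 0) s
        + ((κ + 1) / s : ℝ) * mode (κ + 1) l (fun p => v p 1) s) * Complex.I_mul_I)
  have hia := integrableOn_sq_div h0 hA
    (fun s hs => (hab s hs).1.continuousAt.continuousWithinAt)
    (lintegral_mode_lt_top (memLp_apply (H.memLp_grad 1) 0) κ l) hA1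
  have hib := integrableOn_sq_div h1 hB
    (fun s hs => (hab s hs).2.continuousAt.continuousWithinAt)
    (lintegral_mode_lt_top (memLp_apply (H.memLp_grad 1) 1) (κ + 1) l) hB1
  have hi1 : IntegrableOn (fun s => (‖a s‖ ^ 2 + ‖b s‖ ^ 2) / s) (Set.Ioo 0 R) := by
    simp_rw [add_div]
    exact hia.add hib
  have hi2 : IntegrableOn (fun s => (‖b s‖ ^ 2 + ‖a s‖ ^ 2) / s) (Set.Ioo 0 R) := by
    simp_rw [add_div]
    exact hib.add hia
  refine ⟨a, b, _, hA, hB, hab.isRadial hi1, ?_⟩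
  -- `Re⟨a, b⟩` is symmetric, so one `Z` serves both orderings of the pair.
  simp_rw [real_inner_comm (b _) (a _)]
  exact hab.swap.isRadial hi2

end Dirac

/-! ### Summation over the modes -/

lemma enorm_sq_eq_sum (x : Spinor) : ‖x‖ₑ ^ 2 = ∑ j, ‖x j‖ₑ ^ 2 := by
  simp_rw [← ofReal_norm, ← ENNReal.ofReal_pow (norm_nonneg _)]
  rw [EuclideanSpace.norm_sq_eq, ENNReal.ofReal_sum_of_nonneg fun j _ => by positivity]

lemma mul_lintegral_enorm_sq {R : ℝ} {f : Coord → Spinor} (hf : MemLp f 2 (tubeMeasure R))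
    (α : Fin 2 → ℝ) (β : ℝ) :
    ENNReal.ofReal (2 * Real.pi) ^ 2 * ∫⁻ p, ‖f p‖ₑ ^ 2 ∂tubeMeasure R =
      ∑ j, ∑' m : ℤ, ∑' n : ℤ,
        ∫⁻ r, ‖mode (m + α j) (n + β) (fun p => f p j) r‖ₑ ^ 2 ∂radialMeasure R := by
  simp_rw [fun j => tsum_lintegral_mode (α j) β (memLp_apply hf j), ← Finset.mul_sum,
    enorm_sq_eq_sum]
  rw [lintegral_finsetSum' _ fun j _ =>
    (memLp_apply hf j).aestronglyMeasurable.enorm.pow_const 2]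

lemma normSqLTwo_le_of_mode_le {r R c : ℝ} (hc : 0 ≤ c) {f g : Coord → Spinor}
    (hf : MemLp f 2 (tubeMeasure r)) (hg : MemLp g 2 (tubeMeasure R)) (α : Fin 2 → ℝ) (β : ℝ)
    (h : ∀ j, ∀ m n : ℤ,
      ∫⁻ s, ‖mode (m + α j) (n + β) (fun p => f p j) s‖ₑ ^ 2 ∂radialMeasure r ≤
        ENNReal.ofReal c *
          ∫⁻ s, ‖mode (m + α j) (n + β) (fun p => g p j) s‖ₑ ^ 2 ∂radialMeasure R) :
    normSqLTwo r f ≤ c * normSqLTwo R g := by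
  have hT : ENNReal.ofReal (2 * Real.pi) ^ 2 ≠ 0 := by
    have := Real.pi_pos
    simp [this]
  have hg0 : 0 ≤ normSqLTwo R g := integral_nonneg fun p => by positivity
  rw [← ENNReal.ofReal_le_ofReal_iff (by positivity), ENNReal.ofReal_mul hc, normSqLTwo, normSqLTwo,
    ofReal_integral_norm_sq hf, ofReal_integral_norm_sq hg,
    ← ENNReal.mul_le_mul_iff_right hT (by finiteness), mul_left_comm,
    mul_lintegral_enorm_sq hf α β, mul_lintegral_enorm_sq hg α β, Finset.mul_sum]
  refine Finset.sum_le_sum fun j _ => ?_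
  simp_rw [← ENNReal.tsum_mul_left]
  exact ENNReal.tsum_le_tsum fun m => ENNReal.tsum_le_tsum fun n => h j m n

lemma char_intCast_two_pi (n : ℤ) : char n (2 * Real.pi) = 1 := by
  rw [char, Complex.exp_eq_one_iff]
  refine ⟨-n, ?_⟩
  push_cast
  ring

lemma char_half_two_pi : char (1 / 2) (2 * Real.pi) = -1 := by
  rw [char, ← Complex.exp_pi_mul_I, Complex.exp_eq_exp_iff_exists_int]
  refine ⟨-1, ?_⟩
  push_cast
  ring

/-- Frequencies along the core are integers or half-integers according to the sign `ε`. -/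
lemma exists_twist (ε : ℤˣ) :
    ∃ δ : ℝ, ∀ n : ℤ, char (n + δ) (2 * Real.pi) * ((ε : ℤ) : ℂ) = 1 := by
  rcases Int.units_eq_one_or ε with rfl | rfl
  · exact ⟨0, fun n => by rw [add_zero, char_intCast_two_pi]; simp⟩
  · exact ⟨1 / 2, fun n => by rw [char_add, char_intCast_two_pi, char_half_two_pi]; simp⟩

lemma char_intCast_add_half_two_pi (m : ℤ) : char (m + 1 / 2) (2 * Real.pi) = -1 := by
  rw [char_add, char_intCast_two_pi, char_half_two_pi, one_mul]

/-- The square is `m(m + 1) + 1/4`, and a product of consecutive integers is nonnegative. -/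
lemma quarter_le_sq_intCast_add_half (m : ℤ) : 1 / 4 ≤ ((m : ℝ) + 1 / 2) ^ 2 := by
  have h : 0 ≤ m * (m + 1) := by
    rcases le_or_gt 0 m with hm | hm
    · positivity
    · exact mul_nonneg_of_nonpos_of_nonpos (by omega) (by omega)
  have h' : (0 : ℝ) ≤ m * (m + 1) := by exact_mod_cast h
  linarith [show ((m : ℝ) + 1 / 2) ^ 2 = m * (m + 1) + 1 / 4 by ring]

lemma lintegral_mode_decay {R r l k : ℝ} {X : ℝ → ℂ} {f g : Coord → ℂ} {Y Z : ℝ → ℝ}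
    (hX : mode k l f =ᵐ[volume.restrict (Set.Ioo 0 R)] X)
    {κ : ℝ} (H : IsRadial κ l R (fun s => ‖X s‖ ^ 2) Y Z) (hκ : 1 / 4 ≤ κ ^ 2)
    (hg : ∀ᵐ s ∂volume.restrict (Set.Ioo 0 R), mode k l g s = Complex.I * l * mode k l f s)
    (hr : 0 < r) (hrR : r ≤ R / 2) :
    ∫⁻ s, ‖mode k l f s‖ₑ ^ 2 ∂radialMeasure r ≤ ENNReal.ofReal (1024 * r ^ 3 / R ^ 3) *
        ∫⁻ s, ‖mode k l f s‖ₑ ^ 2 ∂radialMeasure R ∧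
    ∫⁻ s, ‖mode k l g s‖ₑ ^ 2 ∂radialMeasure r ≤ ENNReal.ofReal (1024 * r ^ 3 / R ^ 5) *
        ∫⁻ s, ‖mode k l f s‖ₑ ^ 2 ∂radialMeasure R := by
  have hrR' : r ≤ R := by linarith
  rw [lintegral_radialMeasure hrR' hX, lintegral_radialMeasure le_rfl hX]
  refine ⟨H.lintegral_decay hκ hr hrR, ?_⟩
  refine le_trans (le_of_eq ?_) (H.sq_mul_lintegral_decay hκ hr hrR)
  have hgX : mode k l g =ᵐ[volume.restrict (Set.Ioo 0 R)] fun s => Complex.I * l * X s := by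
    filter_upwards [hg, hX] with s h1 h2
    rw [h1, h2]
  rw [lintegral_radialMeasure hrR' hgX, ← lintegral_const_mul' _ _ (by simp)]
  refine lintegral_congr fun s => ?_
  rw [← ENNReal.ofReal_mul (sq_nonneg l), norm_mul, norm_mul, Complex.norm_I, Complex.norm_real,
    Real.norm_eq_abs, mul_pow, mul_pow, sq_abs]
  congr 1
  ring

/-- The offsets `1/2` and `3/2` index the components so that the same `m` labels the coupled pair `κ
= m + 1/2` and `κ + 1`. -/
lemma HasLTwoOneGrad.mode_decay {ε : ℤˣ} {R r δ : ℝ} {v : Coord → Spinor}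
    {G : Fin 3 → Coord → Spinor} (H : HasLTwoOneGrad ε R v G)
    (hD : ∀ᵐ p ∂tubeMeasure R, dirac G p = 0)
    (hδ : ∀ n : ℤ, char (n + δ) (2 * Real.pi) * ((ε : ℤ) : ℂ) = 1)
    (hr : 0 < r) (hrR : r ≤ R / 2) (j : Fin 2) (m n : ℤ) :
    ∫⁻ s, ‖mode (m + ![1 / 2, 3 / 2] j) (n + δ) (fun p => v p j) s‖ₑ ^ 2 ∂radialMeasure r ≤
      ENNReal.ofReal (1024 * r ^ 3 / R ^ 3) *
        ∫⁻ s, ‖mode (m + ![1 / 2, 3 / 2] j) (n + δ) (fun p => v p j) s‖ₑ ^ 2 ∂radialMeasure R ∧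
    ∫⁻ s, ‖mode (m + ![1 / 2, 3 / 2] j) (n + δ) (fun p => G 2 p j) s‖ₑ ^ 2 ∂radialMeasure r ≤
      ENNReal.ofReal (1024 * r ^ 3 / R ^ 5) *
        ∫⁻ s, ‖mode (m + ![1 / 2, 3 / 2] j) (n + δ) (fun p => v p j) s‖ₑ ^ 2
          ∂radialMeasure R := by
  have hR : 0 < R := by linarith
  have hsucc : (m : ℝ) + 1 / 2 + 1 = ((m + 1 : ℤ) : ℝ) + 1 / 2 := by push_cast; ring
  have hq := quarter_le_sq_intCast_add_half m
  have hq' : 1 / 4 ≤ ((m : ℝ) + 1 / 2 + 1) ^ 2 := hsucc ▸ quarter_le_sq_intCast_add_half (m + 1)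
  have hne : ∀ x : ℝ, 1 / 4 ≤ x ^ 2 → x ≠ 0 := by
    rintro x hx rfl
    norm_num at hx
  obtain ⟨a, b, Z, ha, hb, h1, h2⟩ := H.exists_isRadial hD hR
    (char_intCast_add_half_two_pi m) (hsucc ▸ char_intCast_add_half_two_pi (m + 1))
    (hne _ hq) (hne _ hq') (hδ n)
  fin_cases j
  · exact lintegral_mode_decay ha h1 hq (H.mode_grad_two _ (hδ n) 0) hr hrR
  · have h32 : (m : ℝ) + 3 / 2 = m + 1 / 2 + 1 := by ring
    simp only [Fin.mk_one, Matrix.cons_val_one, Matrix.cons_val_fin_one, h32]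
    exact lintegral_mode_decay hb h2 (by rwa [neg_sq]) (H.mode_grad_two _ (hδ n) 1) hr hrR

end ZTwoSpinor

theorem theorem4p9 :
    ∃ C : ℝ, 0 < C ∧
      ∀ (ε : ℤˣ) (R : ℝ), 0 < R →
      ∀ (v : ZTwoSpinor.Coord → ZTwoSpinor.Spinor)
        (G : Fin 3 → ZTwoSpinor.Coord → ZTwoSpinor.Spinor),
        ZTwoSpinor.HasLTwoOneGrad ε R v G →
        (∀ᵐ p ∂(ZTwoSpinor.tubeMeasure R), ZTwoSpinor.dirac G p = 0) →
        ∀ r : ℝ, 0 < r → r ≤ R / 2 →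
          ZTwoSpinor.normSqLTwo r v ≤ C * r ^ 3 / R ^ 3 * ZTwoSpinor.normSqLTwo R v ∧
          ZTwoSpinor.normSqLTwo r (G 2) ≤ C * r ^ 3 / R ^ 5 * ZTwoSpinor.normSqLTwo R v := by
  -- `1024 = 2 · 512`: the factor `2` is from `IsRadial.lintegral_le`, the `512` from
  -- `IsRadial.sq_mul_X_half_le_lintegral`.
  refine ⟨1024, by norm_num, fun ε R hR v G H hD r hr hrR => ?_⟩
  obtain ⟨δ, hδ⟩ := ZTwoSpinor.exists_twist ε
  have hmono := ZTwoSpinor.tubeMeasure_mono (r := r) (R := R) (by linarith)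
  have hdecay := H.mode_decay hD hδ hr hrR
  exact ⟨ZTwoSpinor.normSqLTwo_le_of_mode_le (by positivity) (H.memLp.mono_measure hmono) H.memLp
      _ δ fun j m n => (hdecay j m n).1,
    ZTwoSpinor.normSqLTwo_le_of_mode_le (by positivity) ((H.memLp_grad 2).mono_measure hmono)
      H.memLp _ δ fun j m n => (hdecay j m n).2⟩
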